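/- **Setting.** Processes from an arbitrary, possibly infinite, set $P$ (unknown participants) communicate asynchronously through atomic registers and atomic snapshot objects; they may stop at any time. A sequential data type is given by a set $S$ of states, an initial state $s_0$ and a transition function $\tau(s,op)=(s',v)$, where $s'$ is the new state and $v$ the response. **Algorithm.** The shared memory consists of a snapshot object $L$ (initially $L[p]=\bot$ for all $p$) and of consensus objects $F(0),F(1),\dots$, which are recycled: $\langle F(l),t\rangle$ denotes the use of $F(l)$ in round $t$. Every register of $F(l)$ stores its value together with a timestamp, initially $0$; a write in round $t$ stores timestamp $t$, and a read in round $t$ returns the initial value of the register if the stored timestamp is smaller than $t$, and the stored value otherwise. Each process $p$ has persistent local variables $s$ (initially $s_0$) and $l,t$ (initially $0$). To execute $op$, process $p$ repeats the following: it writes $L[p]\leftarrow l$, then reads the decision register of $C=\langle F(l),t\rangle$. If this contains a decision $(s_1,q,l_1,t_1)$, then it sets $(s,l,t)\leftarrow(s_1,l_1,t_1)$ and starts over. Otherwise, let $(s',v)=\tau(s,op)$. If $s'=s$, it returns $v$. If not, it computes the smallest natural $f$ that does not appear in $L$, and proposes $(s',p,f,t+1)$ to $C$; if the decision is the one that $p$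 proposed it returns $v$, and otherwise it starts over. A consensus object has a decision register $d$ (initially $\bot$), a racing object and one grafarius for each lap $1,2,\dots$. To propose $u$, process $p$ repeats: if $d\ne\bot$ return $d$; enter a lap of the racing; execute $(f,u)\leftarrow \mathit{adoptCommit}(u)$ on its grafarius; if $f=\mathit{commit}$, write $d\leftarrow u$ and return $u$. To enter a lap, $p$ writes the last lap it left ($0$ if none) in its component of a snapshot object, and reads the maximum $m$ of this snapshot; if $m$ is the last lap that $p$ left it enters $m+1$, and otherwise $m$. A grafarius consists of a splitter, a flag $c$ (initially false) and a register $d$ (initially $\bot$). In $\mathit{adoptCommit}(u)$, a process that loses the splitter sets $c\leftarrow\mathit{true}$ and reads $d$; if $d\neq\bot$ it returns $(\mathit{adopt},d)$, and otherwise it writes $d\leftarrow u$ and returns $(\mathit{adopt},u)$. A process that wins the splitter writes $d\leftarrow u$ and returns $(\mathit{adopt},u)$ if $c$ is true, and $(\mathit{commit},u)$ otherwise. In the splitter, made of registers $x$ (initially $\bot$) and $y$ (initially false), process $p$ writes $x\leftarrow p$, loses if $y$ is true, and otherwise writes $y\leftarrow\mathit{true}$ and wins if and only if $x=p$. **Theorem.**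 For every set $P$ of processes and every sequential data type $T$, this algorithm is an obstruction-free linearizable implementation of $T$, that is, it is an obstruction-free linearizable universal construction: 1. (Obstruction-freedom) at any point of any execution, a process with a pending operation that from then on runs alone completes this operation after finitely many steps; 2. (Linearizability) the history of invocations and responses of every finite execution is linearizable with respect to $T$: all complete operations, with their responses, and some of the pending ones, with suitable responses, can be put in a sequential order that is legal for $T$ from $s_0$ and that extends the real-time precedence order; 3. (Recycling) in every execution in which $k$ processes invoke operations, no consensus object other than $F(0),\dots,F(k)$ is ever accessed. -/

import Mathlib

/-! ## Sequential data types, histories and linearizability -/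

/-- A sequential data type: an initial state and a total transition function
`τ (s, op) = (s', v)` giving the new state and the response. -/
structure SeqType (S O R : Type*) where
  init : S
  τ : S → O → S × R

/-- `T.Legal s l`: executing the operations of `l` in order from state `s`, every
operation returns the response recorded with it. -/
def SeqType.Legal {S O R : Type*} (T : SeqType S O R) : S → List (O × R) → Prop
  | _, [] => True
  | s, (o, v) :: l => (T.τ s o).2 = v ∧ T.Legal (T.τ s o).1 l

/-- Invocation and response events of the implemented (high-level) object. -/
inductive Event (P O R : Type*)
  | inv (p : P) (o : O)
  | res (p : P) (v : R)

/-- The operation invoked at position `i` of the history `h` returns `v` at position `j`. -/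
def Returns {P O R : Type*} (h : List (Event P O R)) (i j : ℕ) (v : R) : Prop :=
  ∃ p o, h[i]? = some (.inv p o) ∧ i < j ∧ h[j]? = some (.res p v) ∧
    ∀ k w, i < k → k < j → h[k]? ≠ some (.res p w)

/-- An operation of a linearization: the position of its invocation in the history, the
operation, and the response it is given. -/
structure LinOp (O R : Type*) where
  pos : ℕ
  op : O
  resp : R

/-- `l` is a linearization of `h` (Herlihy and Wing): a legal sequential ordering of all the
complete operations of `h`, with their responses, and of some of the pending ones, that extends
the real-time precedence order of `h` (`y` precedes `x` if `y` returns before `x` is invoked). -/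
structure IsLinearization {P S O R : Type*} (T : SeqType S O R) (h : List (Event P O R))
    (l : List (LinOp O R)) : Prop where
  nodup : (l.map LinOp.pos).Nodup
  invoked : ∀ x ∈ l, ∃ p, h[x.pos]? = some (.inv p x.op)
  complete : ∀ i j v, Returns h i j v → ∃ x ∈ l, x.pos = i ∧ x.resp = v
  realTime : l.Pairwise fun x y => ¬ ∃ j v, Returns h y.pos j v ∧ j < x.pos
  legal : T.Legal T.init (l.map fun x => (x.op, x.resp))

/-! ## Asynchronous shared-memory implementations -/

/-- An implementation of a shared object in asynchronous shared memory, for the processes `P`.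
A process is either idle, with a persistent local state in `Idle`, or running an operation, with
a local state in `Run`. An atomic step either continues the operation or ends it, with a response. -/
structure Implementation (P O R : Type*) where
  Mem : Type*
  Idle : Type*
  Run : Type*
  mem₀ : Mem
  idle₀ : Idle
  invoke : Idle → O → Run
  step : P → Mem → Run → Mem × (Run ⊕ (Idle × R))

namespace Implementation

variable {P O R : Type*}

structure Config (A : Implementation P O R) where
  mem : A.Mem
  proc : P → A.Idle ⊕ A.Run

def initial (A : Implementation P O R) : A.Config := ⟨A.mem₀, fun _ => .inl A.idle₀⟩

open Classical in
/-- The configuration where the memory is `m`, and where `p`, only, moved to local state `x`. -/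
noncomputable def Config.move {A : Implementation P O R} (c : A.Config) (m : A.Mem) (p : P)
    (x : A.Idle ⊕ A.Run) : A.Config :=
  ⟨m, Function.update c.proc p x⟩

/-- `A.Reach h c`: some finite execution of `A`, that is, some interleaving of invocations and of
atomic steps of the processes, produces the history `h` and ends in the configuration `c`.
Processes may stop at any point. -/
inductive Reach (A : Implementation P O R) : List (Event P O R) → A.Config → Prop
  | init : A.Reach [] A.initial
  | invoke {h c} (p : P) (o : O) (i : A.Idle) : A.Reach h c → c.proc p = .inl i →
      A.Reach (h ++ [.inv p o]) (c.move c.mem p (.inr (A.invoke i o)))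
  | step {h c} (p : P) (r r' : A.Run) (m : A.Mem) : A.Reach h c → c.proc p = .inr r →
      A.step p c.mem r = (m, .inl r') →
      A.Reach h (c.move m p (.inr r'))
  | respond {h c} (p : P) (r : A.Run) (m : A.Mem) (i : A.Idle) (v : R) : A.Reach h c →
      c.proc p = .inr r → A.step p c.mem r = (m, .inr (i, v)) →
      A.Reach (h ++ [.res p v]) (c.move m p (.inl i))

/-- Running alone from memory `m` and local state `r`, process `p` completes its operation after
finitely many steps. -/
inductive CompletesSolo (A : Implementation P O R) (p : P) : A.Mem → A.Run → Prop
  | done {m r} (m' : A.Mem) (x : A.Idle × R) : A.step p m r = (m', .inr x) →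
      A.CompletesSolo p m r
  | more {m r} (m' : A.Mem) (r' : A.Run) : A.step p m r = (m', .inl r') →
      A.CompletesSolo p m' r' → A.CompletesSolo p m r

/-- Obstruction-freedom: at any point of any execution, a process that has a pending operation
and from then on runs alone completes this operation. -/
def ObstructionFree (A : Implementation P O R) : Prop :=
  ∀ h c, A.Reach h c → ∀ p r, c.proc p = .inr r → A.CompletesSolo p c.mem r

/-- Every history of `A` is linearizable with respect to `T`. -/
def Linearizable {S : Type*} (A : Implementation P O R) (T : SeqType S O R) : Prop :=
  ∀ h c, A.Reach h c → ∃ l, IsLinearization T h l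

end Implementation

/-! ## Base objects -/

/-- An atomic register of a recycled object. It holds the last value written and the timestamp of
the round in which it was written. -/
structure Stamped (α : Type*) where
  ts : ℕ
  val : α

/-- Read in round `t` of a register with initial value `init`: what was written in rounds prior to
`t` is ignored. A write of `v` in round `t` stores `⟨t, v⟩`. -/
def Stamped.read {α : Type*} (r : Stamped α) (init : α) (t : ℕ) : α :=
  if r.ts < t then init else r.val

/-- The registers of a recycled grafarius: those of a splitter, `x` (the last process to arrive)
and `y` (door closed), the contention flag `c`, and the decision `d`. -/
structure Grafarius (P V : Type*) where
  x : Stamped (Option P)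
  y : Stamped Bool
  c : Stamped Bool
  d : Stamped (Option V)

/-- The shared variables of a recycled consensus object: the decision register `d`, the snapshot
object `laps` of the racing (for each process, the last lap it left, with laps numbered from `1`
and `0` for none), and the grafarius of each lap. -/
structure Consensus (P V : Type*) where
  d : Stamped (Option V)
  laps : P → Stamped ℕ
  graf : ℕ → Grafarius P V

def Grafarius.init (P V : Type*) : Grafarius P V :=
  ⟨⟨0, none⟩, ⟨0, false⟩, ⟨0, false⟩, ⟨0, none⟩⟩

def Consensus.init (P V : Type*) : Consensus P V :=
  ⟨⟨0, none⟩, fun _ => ⟨0, 0⟩, fun _ => Grafarius.init P V⟩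

/-! ## The bounded universal construction -/

namespace Buniv

variable {P S O R : Type*}

/-- The values on which consensus is reached: the next state of the object, the process that
proposes it, and the index and the timestamp of the next consensus object to use. -/
structure Decision (P S : Type*) where
  state : S
  proc : P
  idx : ℕ
  ts : ℕ

/-- The shared memory: the snapshot object `L` that stores for each process the index of the
consensus object it is using (`none` for a process that never took part), and the consensus
objects, to be recycled, indexed by the naturals. -/
structure Mem (P S : Type*) where
  L : P → Option ℕ
  cons : ℕ → Consensus P (Decision P S)

/-- The persistent local variables of a process: a state `s` of the implemented object, and the
index `l` and the timestamp `t` of the recycled consensus object `C = ⟨F l, t⟩` in use. -/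
structure View (S : Type*) where
  s : S
  l : ℕ
  t : ℕ

/-- Program counter. In the calls to `propose`, `u` is the current estimate and `n` the current lap
(`0` before the first one). -/
inductive PC (P S R : Type*)
  | enter
  | check
  | free
  | test (u : Decision P S) (n : ℕ)
  | leave (u : Decision P S) (n : ℕ)
  | race (u : Decision P S) (n : ℕ)
  | splitSetX (u : Decision P S) (n : ℕ)
  | splitGetY (u : Decision P S) (n : ℕ)
  | splitSetY (u : Decision P S) (n : ℕ)
  | splitGetX (u : Decision P S) (n : ℕ)
  | loseSetC (u : Decision P S) (n : ℕ)
  | loseGetD (u : Decision P S) (n : ℕ)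
  | loseSetD (u : Decision P S) (n : ℕ)
  | winSetD (u : Decision P S) (n : ℕ)
  | winGetC (u : Decision P S) (n : ℕ)
  | decide (u : Decision P S)
  | ret (v : R)

/-- Local state of a process that is executing operation `op`. -/
structure Run (P S O R : Type*) where
  view : View S
  op : O
  pc : PC P S R

/-- Replace the consensus object of index `k`. -/
def Mem.setCons (m : Mem P S) (k : ℕ) (o : Consensus P (Decision P S)) : Mem P S :=
  { m with cons := Function.update m.cons k o }

/-- Replace, in the consensus object of index `k`, the grafarius of lap `n`. -/
def Mem.setGraf (m : Mem P S) (k n : ℕ) (g : Grafarius P (Decision P S)) : Mem P S :=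
  m.setCons k { m.cons k with graf := Function.update (m.cons k).graf n g }

/-- The smallest index that appears nowhere in `L`. -/
noncomputable def freeIndex (L : P → Option ℕ) : ℕ := sInf {k | ∀ q, L q ≠ some k}

/-- The greatest lap left by some process, as seen in round `t` (there are always finitely many
processes that left a lap). -/
noncomputable def maxLap (laps : P → Stamped ℕ) (t : ℕ) : ℕ := ⨆ q, (laps q).read 0 t

open Classical in
/-- The call to `propose` returned the decision `w`: the operation returns if `w` was proposed by
`p` and starts over otherwise. -/
noncomputable def proposed (T : SeqType S O R) (p : P) (r : Run P S O R)
    (w : Decision P S) : PC P S R :=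
  if w.proc = p then .ret (T.τ r.view.s r.op).2 else .enter

open Classical in
/-- The code of the algorithm. Each case accesses at most one base object (a register, or one of
the snapshot objects `L` and `laps`), once, and then goes to the next program counter.

```
enter() :=                                   free() :=
  L[p] := l                                    return the smallest k not in L
  return C = ⟨F l, t⟩

invoke(op) :=                                propose(u) :=   (on ⟨o, t⟩, R the racing of o)
  loop                                         loop
    C := enter()                                 if d ≠ ⊥ then return d
    d := C.d                                     (f, u) := R.enter().adoptCommit(u)
    if d ≠ ⊥ then                                if f = commit then d := u; return u
      (s, _, l, t) := d
      continue                               R.enter() :=    (initially lastlap = 0)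
    (s', v) := τ(s, op)                        laps[p] := lastlap
    if s' = s then return v                    m := max laps
    d := C.propose((s', p, free(), t + 1))     if m = lastlap then lastlap := lastlap + 1
    if d = (_, p, _, _) then return v          else lastlap := m
                                               return the grafarius of lap lastlap

adoptCommit(u) :=                            split() :=
  if not split() then                          x := p
    c := true                                  if y then return false
    if d ≠ ⊥ then return (adopt, d)            y := true
    d := u                                     return (x = p)
    return (adopt, u)
  d := u
  if c then return (adopt, u)
  return (commit, u)
``` -/
noncomputable def step (T : SeqType S O R) (p : P) (m : Mem P S) (r : Run P S O R) :
    Mem P S × (Run P S O R ⊕ (View S × R)) :=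
  let s := r.view.s
  let l := r.view.l
  let t := r.view.t
  let o := m.cons l
  let goto : PC P S R → Run P S O R ⊕ (View S × R) := fun pc => .inl { r with pc := pc }
  match r.pc with
  -- enter()
  | .enter => ({ m with L := Function.update m.L p (some l) }, goto .check)
  -- read of the decision register of C
  | .check =>
    match o.d.read none t with
    | some w => (m, .inl { r with view := ⟨w.state, w.idx, w.ts⟩, pc := .enter })
    | none =>
      if (T.τ s r.op).1 = s then (m, goto (.ret (T.τ s r.op).2)) else (m, goto .free)
  -- free(), then the call to propose
  | .free => (m, goto (.test ⟨(T.τ s r.op).1, p, freeIndex m.L, t + 1⟩ 0))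
  -- test of the decision register in propose
  | .test u n =>
    match o.d.read none t with
    | some w => (m, goto (proposed T p r w))
    | none => (m, goto (.leave u n))
  -- R.enter()
  | .leave u n =>
    (m.setCons l { o with laps := Function.update o.laps p ⟨t, n⟩ }, goto (.race u n))
  | .race u n =>
    (m, goto (.splitSetX u (if maxLap o.laps t = n then n + 1 else maxLap o.laps t)))
  -- split()
  | .splitSetX u n => (m.setGraf l n { o.graf n with x := ⟨t, some p⟩ }, goto (.splitGetY u n))
  | .splitGetY u n =>
    if (o.graf n).y.read false t = true then (m, goto (.loseSetC u n))
    else (m, goto (.splitSetY u n))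
  | .splitSetY u n => (m.setGraf l n { o.graf n with y := ⟨t, true⟩ }, goto (.splitGetX u n))
  | .splitGetX u n =>
    if (o.graf n).x.read none t = some p then (m, goto (.winSetD u n))
    else (m, goto (.loseSetC u n))
  -- adoptCommit(u), splitter lost
  | .loseSetC u n => (m.setGraf l n { o.graf n with c := ⟨t, true⟩ }, goto (.loseGetD u n))
  | .loseGetD u n =>
    match (o.graf n).d.read none t with
    | some w => (m, goto (.test w n))
    | none => (m, goto (.loseSetD u n))
  | .loseSetD u n => (m.setGraf l n { o.graf n with d := ⟨t, some u⟩ }, goto (.test u n))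
  -- adoptCommit(u), splitter won
  | .winSetD u n => (m.setGraf l n { o.graf n with d := ⟨t, some u⟩ }, goto (.winGetC u n))
  | .winGetC u n =>
    if (o.graf n).c.read false t = true then (m, goto (.test u n)) else (m, goto (.decide u))
  -- commit
  | .decide u => (m.setCons l { o with d := ⟨t, some u⟩ }, goto (proposed T p r u))
  -- response
  | .ret v => (m, .inr (r.view, v))

/-- The bounded universal construction, for the data type `T` and the set of potential processes
`P`, which may be infinite. -/
noncomputable def algorithm (P : Type*) {S O R : Type*} (T : SeqType S O R) :
    Implementation P O R where
  Mem := Mem P S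
  Idle := View S
  Run := Run P S O R
  mem₀ := ⟨fun _ => none, fun _ => Consensus.init P (Decision P S)⟩
  idle₀ := ⟨T.init, 0, 0⟩
  invoke := fun view op => ⟨view, op, .enter⟩
  step := step T

/-- The processes that invoke some operation in the history `h`. -/
def participants (h : List (Event P O R)) : Set P := {p | ∃ o, Event.inv p o ∈ h}

/-- The index of the consensus object that a process in the given local state uses. -/
def index : View S ⊕ Run P S O R → ℕ
  | .inl i => i.l
  | .inr r => r.view.l

/-- In an execution with `k` participants, the consensus objects of index `0, …, k` are the only
ones that are ever accessed: the `k + 1` of them are recycled. -/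
def RecyclesConsensus (P : Type*) {S O R : Type*} (T : SeqType S O R) : Prop :=
  ∀ (h : List (Event P O R)) (c : (algorithm P T).Config), (algorithm P T).Reach h c →
    (∀ p, index (c.proc p) ≤ (participants h).ncard) ∧
    ∀ k, (participants h).ncard < k → c.mem.cons k = Consensus.init P (Decision P S)

end Buniv

/-! **Agreement.** Read through timestamps, a recycled consensus object looks like a fresh one-shot
object in each round (`Consensus.snap`), so agreement is proved for a fixed round. A process gets
past a lap only when the contention flags of this lap and of all earlier ones are raised. Hence,
when the winner of a splitter finds its flag down, nobody has left its lap or entered a later one.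
The losers of that lap raise the flag before they read `d`, so they adopt the winner's value. A
process that jumps ahead with an old estimate lands in a lap that another process has left: its door
is closed and its `d` holds the committed value. `Snap.Inv` and `Snap.Committed` express this, and
`Snap.Inv.step` and `Snap.Committed.step` preserve it; `Snap.Uses.of_step` gives validity.

**Linearizability.** The decisions of the successive rounds form a list `D` (`Safe`). A process
announces its index in `L` before it reads that its round is undecided, and a proposer picks an
index absent from `L`. Whoever finds its round undecided later on is in the last round, whose index
the proposer itself announces. So no object is reused while a process is proposing on it, and a new
round starts from registers that all read as initial (`Safe.append`). A slow process that comes back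
to a reused object finds a later decision there and jumps. An update is linearized when the decision
it proposed is first written, perhaps by another process; an operation that leaves the state
unchanged, when its process finds the round undecided (`Linearizes`, `Safe.step`).

**Obstruction-freedom.** Alone, a process strictly increases its lap until it meets an untouched
grafarius, where it commits, and strictly increases its round until it exceeds all timestamps in
memory, where its own proposal is decided (`Solo.test`, `Solo.of_wf`).

**Recycling.** With `k` participants `L` holds at most `k` indices, so one of `0, …, k` is free
(`freeIndex_spec`); all other indices are copies of indices so chosen (`Basic`). -/

namespace Buniv

variable {P S O R : Type*}

/-! ### Agreement and validity of a consensus object in a fixed round -/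

/-- The estimate of a process that is executing `propose`. -/
def PC.est : PC P S R → Option (Decision P S)
  | .test u _ | .leave u _ | .race u _ | .splitSetX u _ | .splitGetY u _ | .splitSetY u _
  | .splitGetX u _ | .loseSetC u _ | .loseGetD u _ | .loseSetD u _ | .winSetD u _
  | .winGetC u _ | .decide u => some u
  | _ => none

/-- What the registers of a consensus object, other than its decision register, look like when
they are read in a given round. -/
structure Snap (P V : Type*) where
  x : ℕ → Option P
  y : ℕ → Bool
  c : ℕ → Bool
  d : ℕ → Option V
  laps : P → ℕ

open Classical in
/-- The steps of `propose`, seen in a fixed round: `p` moves from a program counter to the next,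
while the registers change from `σ` to the second snapshot. -/
inductive ProposeStep (p : P) (σ : Snap P (Decision P S)) :
    PC P S R → Snap P (Decision P S) → PC P S R → Prop
  | exit {pc pc'} : pc'.est = none → ProposeStep p σ pc σ pc'
  | start {pc u} : pc.est = none → ProposeStep p σ pc σ (.test u 0)
  | test {u n} : ProposeStep p σ (.test u n) σ (.leave u n)
  | leave {u n} : ProposeStep p σ (.leave u n)
      { σ with laps := Function.update σ.laps p n } (.race u n)
  | race {u n m} : (∀ q, σ.laps q ≤ m) → (∃ q, σ.laps q = m) →
      ProposeStep p σ (.race u n) σ (.splitSetX u (if m = n then n + 1 else m))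
  | splitSetX {u n} : ProposeStep p σ (.splitSetX u n)
      { σ with x := Function.update σ.x n (some p) } (.splitGetY u n)
  | closed {u n} : σ.y n = true → ProposeStep p σ (.splitGetY u n) σ (.loseSetC u n)
  | opened {u n} : σ.y n = false → ProposeStep p σ (.splitGetY u n) σ (.splitSetY u n)
  | splitSetY {u n} : ProposeStep p σ (.splitSetY u n)
      { σ with y := Function.update σ.y n true } (.splitGetX u n)
  | win {u n} : σ.x n = some p → ProposeStep p σ (.splitGetX u n) σ (.winSetD u n)
  | lose {u n} : ProposeStep p σ (.splitGetX u n) σ (.loseSetC u n)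
  | loseSetC {u n} : ProposeStep p σ (.loseSetC u n)
      { σ with c := Function.update σ.c n true } (.loseGetD u n)
  | adopt {u n w} : σ.d n = some w → ProposeStep p σ (.loseGetD u n) σ (.test w n)
  | empty {u n} : σ.d n = none → ProposeStep p σ (.loseGetD u n) σ (.loseSetD u n)
  | loseSetD {u n} : ProposeStep p σ (.loseSetD u n)
      { σ with d := Function.update σ.d n (some u) } (.test u n)
  | winSetD {u n} : ProposeStep p σ (.winSetD u n)
      { σ with d := Function.update σ.d n (some u) } (.winGetC u n)
  | contended {u n} : σ.c n = true → ProposeStep p σ (.winGetC u n) σ (.test u n)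
  | commit {u n} : σ.c n = false → ProposeStep p σ (.winGetC u n) σ (.decide u)

/-- Some process may have left lap `n` without committing. -/
def Snap.Left (σ : Snap P (Decision P S)) (n : ℕ) : Prop :=
  n = 0 ∨ (σ.y n = true ∧ σ.d n ≠ none ∧ ∀ j, 1 ≤ j → j ≤ n → σ.c j = true)

/-- What is known of the registers when `p` is at a given program counter. -/
def Snap.Local (σ : Snap P (Decision P S)) (p : P) : PC P S R → Prop
  | .test _ n | .leave _ n => σ.Left n
  | .race _ n => σ.Left n ∧ σ.laps p = n
  | .splitSetX _ n | .splitGetY _ n | .splitSetY _ n =>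
    1 ≤ n ∧ ∀ j, 1 ≤ j → j < n → σ.c j = true
  | .splitGetX _ n | .loseSetC _ n | .winSetD _ n =>
    1 ≤ n ∧ σ.y n = true ∧ ∀ j, 1 ≤ j → j < n → σ.c j = true
  | .loseGetD _ n | .loseSetD _ n =>
    1 ≤ n ∧ σ.y n = true ∧ ∀ j, 1 ≤ j → j ≤ n → σ.c j = true
  | .winGetC u n =>
    1 ≤ n ∧ σ.y n = true ∧ (∀ j, 1 ≤ j → j < n → σ.c j = true) ∧ σ.d n ≠ none ∧
      (σ.c n = false → σ.d n = some u)
  | _ => True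

/-- `p` won the splitter of lap `n`, and did not leave this lap yet. -/
def PC.Won (n : ℕ) : PC P S R → Prop
  | .winSetD _ k | .winGetC _ k => k = n
  | _ => False

/-- `p` cannot win the splitter of lap `n`, given that its door is closed. -/
def Snap.Loses (σ : Snap P (Decision P S)) (n : ℕ) (p : P) : PC P S R → Prop
  | .splitSetY _ k | .splitGetX _ k => k = n → σ.x k ≠ some p
  | _ => True

/-- The constraints on `p` once `u` is committed in lap `n`. -/
def Snap.Bound (σ : Snap P (Decision P S)) (n : ℕ) (u : Decision P S) (p : P) : PC P S R → Prop
  | .test w k | .leave w k | .race w k => n ≤ k → w = u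
  | .splitSetX w k | .splitGetY w k | .loseSetC w k | .loseGetD w k =>
    n < k → w = u ∨ (σ.d k ≠ none ∧ σ.y k = true)
  | .splitSetY w k | .splitGetX w k => (n < k → w = u) ∧ (k = n → σ.x k ≠ some p)
  | .loseSetD w k | .winSetD w k | .winGetC w k => n ≤ k → w = u ∧ k ≠ n
  | _ => True

/-- The value `u` is committed in lap `n`. -/
structure Snap.Committed (σ : Snap P (Decision P S)) (a : P → PC P S R) (n : ℕ)
    (u : Decision P S) : Prop where
  pos : 1 ≤ n
  y : σ.y n = true
  d : σ.d n = some u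
  later : ∀ k w, n < k → σ.d k = some w → w = u
  bound : ∀ q, σ.Bound n u q (a q)

/-- The invariant of a consensus object in a given round. -/
structure Snap.Inv (σ : Snap P (Decision P S)) (a : P → PC P S R) : Prop where
  loc : ∀ q, σ.Local q (a q)
  laps : ∀ q, σ.Left (σ.laps q)
  entered : ∀ n, σ.d n ≠ none → ∀ j, 1 ≤ j → j < n → σ.c j = true
  loses : ∀ q n, (a q).Won n → ∀ q', σ.Loses n q' (a q')
  unique : ∀ q q' n, (a q).Won n → (a q').Won n → q = q'
  decide : ∀ q u, a q = .decide u → ∃ n, σ.Committed a n u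

theorem Snap.Committed.unique {σ : Snap P (Decision P S)} {a : P → PC P S R} {n n' : ℕ}
    {u u' : Decision P S} (h : σ.Committed a n u) (h' : σ.Committed a n' u') : u = u' := by
  have := h.later n' u'
  have := h'.later n u
  have := h.d
  have := h'.d
  grind

open Classical in
-- Within a round, doors only close, flags only rise and a decision is never erased.
theorem Snap.Left.step {p : P} {σ σ' : Snap P (Decision P S)} {pc pc' : PC P S R}
    (hs : ProposeStep p σ pc σ' pc') {n : ℕ} (h : σ.Left n) : σ'.Left n := by
  unfold Snap.Left at *
  cases hs <;> grind

open Classical in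
theorem Snap.Bound.step {p q : P} {σ σ' : Snap P (Decision P S)} {pc pc' pc'' : PC P S R}
    (hs : ProposeStep p σ pc σ' pc') {n : ℕ} {u : Decision P S} (hq : q ≠ p)
    (h : σ.Bound n u q pc'') : σ'.Bound n u q pc'' := by
  cases hs <;> cases pc'' <;> simp only [Snap.Bound] at * <;> grind

open Classical in
-- The heart of agreement. Only a process in a lap before `n` can leave it with an estimate other
-- than `u`. If it then races into lap `n` or beyond, either it enters lap `n`, whose door is closed
-- and whose `d` is `u`, or it jumps to a later lap already left by another process. In both cases
-- it loses the splitter and adopts `u`. Processes inside the door of lap `n` have lost `x` to the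
-- winner.
theorem Snap.Committed.step {p : P} {σ σ' : Snap P (Decision P S)} {a : P → PC P S R}
    {pc' : PC P S R} (hI : σ.Inv a) (hs : ProposeStep p σ (a p) σ' pc') {n : ℕ}
    {u : Decision P S} (h : σ.Committed a n u) :
    σ'.Committed (Function.update a p pc') n u := by
  have hb : ∀ q, q ≠ p → σ'.Bound n u q (a q) := fun q hq => (h.bound q).step hs hq
  have hp := h.bound p
  have hl := hI.loc p
  have hlp := hI.laps
  obtain ⟨h1, h2, h3, h4, h5⟩ := h
  have key : σ'.y n = true ∧ σ'.d n = some u ∧ (∀ k w, n < k → σ'.d k = some w → w = u) ∧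
      σ'.Bound n u p pc' := by
    clear hb h5 hI
    generalize a p = pc at *
    cases hs with
    | exit h =>
      refine ⟨h2, h3, h4, ?_⟩
      cases pc' <;> simp_all [Snap.Bound, PC.est]
    -- The maximum is a lap left by some `q`, so `Left` provides the closed door and the nonempty
    -- `d` of the lap entered.
    | race hm hq =>
      obtain ⟨q, hq⟩ := hq
      have := hlp q
      clear hlp
      simp only [Snap.Bound, Snap.Local, Snap.Left] at *
      grind
    | _ => clear hlp; simp only [Snap.Bound, Snap.Local, Snap.Left] at *; grind
  refine ⟨h1, key.1, key.2.1, key.2.2.1, fun q => ?_⟩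
  by_cases hq : q = p
  · subst hq; simpa using key.2.2.2
  · simpa [hq] using hb q hq

open Classical in
-- The delicate fact is the one at `winGetC`: while the flag is down, the winner's value is not
-- overwritten, because losers raise the flag before writing `d` and the winner is unique.
theorem Snap.Local.step {p q : P} {σ σ' : Snap P (Decision P S)} {a : P → PC P S R}
    {pc' : PC P S R} (hI : σ.Inv a) (hs : ProposeStep p σ (a p) σ' pc') (hq : q ≠ p) :
    σ'.Local q (a q) := by
  have hL : ∀ n, σ.Left n → σ'.Left n := fun n h => h.step hs
  have hp := hI.loc p
  have hl := hI.loc q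
  have hu := hI.unique p q
  generalize a p = pc at *
  generalize a q = pc'' at *
  cases hs <;> cases pc'' <;> simp only [Snap.Local, PC.Won] at * <;> grind

open Classical in
-- Since the flag of lap `n` is down, `Local` leaves no process beyond this lap, nor any loser of
-- this lap that has already read `d`.
theorem Snap.Inv.committed {p : P} {σ : Snap P (Decision P S)} {a : P → PC P S R}
    {u : Decision P S} {n : ℕ} (hI : σ.Inv a) (hp : a p = .winGetC u n) (hc : σ.c n = false) :
    σ.Committed (Function.update a p (.decide u)) n u := by
  have h := hI.loc p
  rw [hp] at h
  obtain ⟨h1, h2, -, -, h3⟩ := h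
  refine ⟨h1, h2, h3 hc, ?_, fun q => ?_⟩
  · intro k w hk hw
    -- A value in a later lap would need the flag of lap `n` to be raised.
    have := hI.entered k (by simp [hw]) n h1 hk
    simp_all
  by_cases hq : q = p
  · simp [hq, Snap.Bound]
  have hl := hI.loc q
  have hu := hI.unique p q n (by simp [hp, PC.Won])
  have hlo := hI.loses p n (by simp [hp, PC.Won]) q
  simp only [Function.update_of_ne hq]
  generalize a q = pc at *
  cases pc <;> simp only [Snap.Bound, Snap.Local, PC.Won, Snap.Left, Snap.Loses] at * <;> grind

open Classical in
theorem Snap.Loses.step {p q : P} {σ σ' : Snap P (Decision P S)} {pc pc' pc'' : PC P S R}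
    (hs : ProposeStep p σ pc σ' pc') {n : ℕ} (hq : q ≠ p) (h : σ.Loses n q pc'') :
    σ'.Loses n q pc'' := by
  cases hs <;> cases pc'' <;> simp only [Snap.Loses] at * <;> grind

open Classical in
-- At the moment of winning, `x` names the winner and nobody else. Afterwards a process can put its
-- own name in `x`, but it then meets a closed door.
theorem Snap.Inv.loses_step {p : P} {σ σ' : Snap P (Decision P S)} {a : P → PC P S R}
    {pc' : PC P S R} (hI : σ.Inv a) (hs : ProposeStep p σ (a p) σ' pc') (q : P) (n : ℕ)
    (hq : (Function.update a p pc' q).Won n) (q' : P) :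
    σ'.Loses n q' (Function.update a p pc' q') := by
  by_cases h : q = p
  · subst h
    rw [Function.update_self] at hq
    by_cases h' : q' = q
    · subst h'
      rw [Function.update_self]
      cases pc' <;> simp_all [PC.Won, Snap.Loses]
    · rw [Function.update_of_ne h']
      refine Snap.Loses.step hs h' ?_
      have h2 := fun h => hI.loses q n h q'
      clear hI
      generalize a q = pc at *
      generalize a q' = pc'' at *
      cases hs <;> simp only [PC.Won] at hq h2
      case exit h => cases pc' <;> simp_all [PC.est]
      case win h => cases pc'' <;> simp only [Snap.Loses] <;> grind
      case winSetD => exact h2 hq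
  · rw [Function.update_of_ne h] at hq
    by_cases h' : q' = p
    · subst h'
      rw [Function.update_self]
      have h1 := hI.loses q n hq q'
      have h2 := hI.loc q
      -- A winner has closed the door, so `q'` cannot get to `splitSetY` in lap `n`.
      have hy : σ.y n = true := by
        generalize a q = pc at *
        cases pc <;> simp only [PC.Won, Snap.Local] at * <;> grind
      clear hI
      generalize a q' = pc at *
      cases hs
      case exit h => cases pc' <;> simp_all [Snap.Loses, PC.est]
      all_goals simp only [Snap.Loses] at * ; try grind
    · rw [Function.update_of_ne h']
      exact (hI.loses q n hq q').step hs h'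

open Classical in
theorem Snap.Inv.unique_step {p : P} {σ σ' : Snap P (Decision P S)} {a : P → PC P S R}
    {pc' : PC P S R} (hI : σ.Inv a) (hs : ProposeStep p σ (a p) σ' pc') (q q' : P) (n : ℕ)
    (hq : (Function.update a p pc' q).Won n) (hq' : (Function.update a p pc' q').Won n) :
    q = q' := by
  have key : ∀ q, q ≠ p → (a q).Won n → ¬ pc'.Won n := by
    intro q hqp hq hp
    have h1 := hI.loses q n hq p
    have h2 := hI.unique q p n hq
    clear hI
    generalize a p = pc at *
    cases hs
    case exit h => cases pc' <;> simp_all [PC.Won, PC.est]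
    all_goals simp only [PC.Won, Snap.Loses] at *
    all_goals grind
  have := hI.unique q q' n
  grind

open Classical in
-- Flags of earlier laps pass from lap to lap through the race: the maximum read is a lap that
-- somebody left, so `Left` holds for it.
theorem Snap.Inv.step {p : P} {σ σ' : Snap P (Decision P S)} {a : P → PC P S R}
    {pc' : PC P S R} (hI : σ.Inv a) (hs : ProposeStep p σ (a p) σ' pc') :
    σ'.Inv (Function.update a p pc') := by
  have hL : ∀ n, σ.Left n → σ'.Left n := fun n h => h.step hs
  have hp := hI.loc p
  have hlp := hI.laps
  have hlocp : σ'.Local p pc' := by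
    generalize a p = pc at *
    cases hs with
    | exit h => cases pc' <;> simp_all [Snap.Local, PC.est]
    | race hm hq =>
      obtain ⟨q, hq⟩ := hq
      have := hlp q
      simp only [Snap.Local, Snap.Left] at *
      grind
    | _ => simp only [Snap.Local, Snap.Left] at * <;> grind
  have hd := hI.entered
  refine ⟨fun q => ?_, ?_, ?_, ?_, ?_, ?_⟩
  · by_cases hq : q = p
    · subst hq; simpa using hlocp
    · simpa [hq] using Snap.Local.step hI hs hq
  · generalize a p = pc at *
    cases hs with
    | leave =>
      intro q
      simp only [Snap.Local, Snap.Left, Function.update_apply] at *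
      grind
    | _ => exact fun q => hL _ (hlp q)
  · generalize a p = pc at *
    clear hlp hL
    cases hs <;> simp only [Snap.Local] at * <;> grind
  · exact Snap.Inv.loses_step hI hs
  · exact Snap.Inv.unique_step hI hs
  · intro q u hq
    by_cases hqp : q = p
    · subst hqp
      simp only [Function.update_self] at hq
      subst hq
      generalize hpc : a q = pc at hs
      cases hs with
      | exit h => simp [PC.est] at h
      | commit h => exact ⟨_, hI.committed hpc h⟩
    · rw [Function.update_of_ne hqp] at hq
      obtain ⟨n, hn⟩ := hI.decide q u hq
      exact ⟨n, hn.step hI hs⟩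

/-- The value `w` is in use: it is the estimate of some process, or it is written in the decision
register of some grafarius. -/
def Snap.Uses (σ : Snap P (Decision P S)) (a : P → PC P S R) (w : Decision P S) : Prop :=
  (∃ q, (a q).est = some w) ∨ ∃ n, σ.d n = some w

open Classical in
-- Validity: estimates and decision registers are only copied from one another, and new values come
-- in only at the start of a proposal.
theorem Snap.Uses.of_step {p : P} {σ σ' : Snap P (Decision P S)} {a : P → PC P S R}
    {pc' : PC P S R} (hs : ProposeStep p σ (a p) σ' pc') {w : Decision P S}
    (h : σ'.Uses (Function.update a p pc') w) :
    σ.Uses a w ∨ (a p).est = none ∧ pc' = .test w 0 := by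
  by_cases hst : (a p).est = none ∧ pc' = .test w 0
  · exact .inr hst
  left
  have key : (pc'.est = some w → (a p).est = some w ∨ ∃ n, σ.d n = some w) ∧
      ∀ n, σ'.d n = some w → (a p).est = some w ∨ σ.d n = some w := by
    generalize a p = pc at *
    cases hs
    case exit h => simp_all
    all_goals simp only [PC.est] ; grind
  rcases h with ⟨q, hq⟩ | ⟨n, hn⟩
  · by_cases hqp : q = p
    · subst hqp
      rw [Function.update_self] at hq
      exact (key.1 hq).imp (fun h => ⟨_, h⟩) id
    · rw [Function.update_of_ne hqp] at hq
      exact .inl ⟨q, hq⟩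
  · exact (key.2 n hn).imp (fun h => ⟨_, h⟩) fun h => ⟨n, h⟩

/-- The registers of a consensus object that is not yet used in this round. -/
def Snap.fresh (P V : Type*) : Snap P V :=
  ⟨fun _ => none, fun _ => false, fun _ => false, fun _ => none, fun _ => 0⟩

theorem Snap.inv_fresh {a : P → PC P S R} (h : ∀ q, (a q).est = none) :
    (Snap.fresh P (Decision P S)).Inv a := by
  have h1 : ∀ q n, ¬ (a q).Won n := by
    intro q n hn
    have := h q
    cases hq : a q <;> simp_all [PC.est, PC.Won]
  refine ⟨fun q => ?_, fun q => .inl rfl, fun n hn => absurd rfl hn,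
    fun q n hn => absurd hn (h1 q n), fun q _ n hn => absurd hn (h1 q n), fun q u hq => ?_⟩
  · have := h q
    cases hq : a q <;> simp_all [PC.est, Snap.Local]
  · have := h q
    simp [hq, PC.est] at this

/-! ### From the code to steps seen in a round -/

/-- The registers of a consensus object, as read in round `t`. -/
def _root_.Consensus.snap (o : Consensus P (Decision P S)) (t : ℕ) : Snap P (Decision P S) where
  x n := (o.graf n).x.read none t
  y n := (o.graf n).y.read false t
  c n := (o.graf n).c.read false t
  d n := (o.graf n).d.read none t
  laps q := (o.laps q).read 0 t

@[simp]
theorem _root_.Stamped.read_self {α : Type*} (t : ℕ) (v i : α) : Stamped.read ⟨t, v⟩ i t = v := by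
  simp [Stamped.read]

open Classical in
/-- The effect on a consensus object of a step in which `p`, whose estimate is `u`, writes at most
one register, in round `t`. -/
inductive _root_.Consensus.Writes (p : P) (t : ℕ) (u : Decision P S)
    (o : Consensus P (Decision P S)) : Consensus P (Decision P S) → Prop
  | refl : o.Writes p t u o
  | laps (n : ℕ) : o.Writes p t u { o with laps := Function.update o.laps p ⟨t, n⟩ }
  | graf (n : ℕ) (g : Grafarius P (Decision P S)) : g.x.ts = (o.graf n).x.ts ∨ g.x.ts = t →
      g.y.ts = (o.graf n).y.ts ∨ g.y.ts = t → g.c.ts = (o.graf n).c.ts ∨ g.c.ts = t →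
      g.d = (o.graf n).d ∨ g.d = ⟨t, some u⟩ →
      o.Writes p t u { o with graf := Function.update o.graf n g }

theorem Mem.setCons_self (m : Mem P S) (k : ℕ) : m.setCons k (m.cons k) = m := by
  simp [Mem.setCons]

open Classical in
/-- The steps of the algorithm, by their effect. -/
inductive Move (T : SeqType S O R) (p : P) (m : Mem P S) (r : Run P S O R) :
    Mem P S → Run P S O R ⊕ (View S × R) → Prop
  | enter : r.pc = .enter → Move T p m r { m with L := Function.update m.L p (some r.view.l) }
      (.inl { r with pc := .check })
  | jump (w : Decision P S) : r.pc = .check → (m.cons r.view.l).d.read none r.view.t = some w →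
      Move T p m r m (.inl { r with view := ⟨w.state, w.idx, w.ts⟩, pc := .enter })
  | read : r.pc = .check → (m.cons r.view.l).d.read none r.view.t = none →
      (T.τ r.view.s r.op).1 = r.view.s →
      Move T p m r m (.inl { r with pc := .ret (T.τ r.view.s r.op).2 })
  | free : r.pc = .check → (m.cons r.view.l).d.read none r.view.t = none →
      Move T p m r m (.inl { r with pc := .free })
  | start : r.pc = .free → Move T p m r m (.inl { r with
      pc := .test ⟨(T.τ r.view.s r.op).1, p, freeIndex m.L, r.view.t + 1⟩ 0 })
  | decided (u : Decision P S) (n : ℕ) (w : Decision P S) : r.pc = .test u n →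
      (m.cons r.view.l).d.read none r.view.t = some w →
      Move T p m r m (.inl { r with pc := proposed T p r w })
  | propose (u u' : Decision P S) (o : Consensus P (Decision P S)) (pc : PC P S R) :
      r.pc.est = some u → pc.est = some u' → (m.cons r.view.l).Writes p r.view.t u o →
      ProposeStep p ((m.cons r.view.l).snap r.view.t) r.pc (o.snap r.view.t) pc →
      Move T p m r (m.setCons r.view.l o) (.inl { r with pc := pc })
  | decide (u : Decision P S) : r.pc = .decide u →
      Move T p m r (m.setCons r.view.l { m.cons r.view.l with d := ⟨r.view.t, some u⟩ })
        (.inl { r with pc := proposed T p r u })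
  | ret (v : R) : r.pc = .ret v → Move T p m r m (.inr (r.view, v))

/-- For infinite `P` the supremum could be the junk value `0`; a bound on the stored laps makes it
an attained maximum. -/
theorem maxLap_spec [Nonempty P] {laps : P → Stamped ℕ} (h : ∃ B, ∀ q, (laps q).val ≤ B) (t : ℕ) :
    (∀ q, (laps q).read 0 t ≤ maxLap laps t) ∧ ∃ q, (laps q).read 0 t = maxLap laps t := by
  obtain ⟨B, hB⟩ := h
  have hbdd : BddAbove (Set.range fun q => (laps q).read 0 t) := by
    refine ⟨B, ?_⟩
    rintro _ ⟨q, rfl⟩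
    have := hB q
    simp only [Stamped.read]
    split <;> omega
  exact ⟨fun q => le_ciSup hbdd q, Nat.sSup_mem (Set.range_nonempty _) hbdd⟩

theorem Move.of_step {T : SeqType S O R} {p : P} {m m' : Mem P S} {r : Run P S O R}
    {x : Run P S O R ⊕ (View S × R)} (h : step T p m r = (m', x))
    (hB : ∃ B, ∀ q, ((m.cons r.view.l).laps q).val ≤ B) : Move T p m r m' x := by
  obtain ⟨⟨s, l, t⟩, op, pc⟩ := r
  have : Nonempty P := ⟨p⟩
  have self : ∀ {pc' : PC P S R} {u u' : Decision P S}, pc.est = some u → pc'.est = some u' →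
      ProposeStep p ((m.cons l).snap t) pc ((m.cons l).snap t) pc' →
      Move T p m ⟨⟨s, l, t⟩, op, pc⟩ m (.inl ⟨⟨s, l, t⟩, op, pc'⟩) := by
    intro pc' u u' h1 h2 h3
    have := Move.propose (T := T) (m := m) (r := ⟨⟨s, l, t⟩, op, pc⟩) u u' (m.cons l) pc' h1 h2
      .refl h3
    rwa [Mem.setCons_self] at this
  cases pc <;> simp only [step] at h
  case enter => cases h; exact .enter rfl
  case check =>
    split at h
    · cases h; exact .jump _ rfl ‹_›
    · split at h <;> cases h
      · exact .read rfl ‹_› ‹_›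
      · exact .free rfl ‹_›
  case free => cases h; exact .start rfl
  case test u n =>
    split at h <;> cases h
    · exact .decided u n _ rfl ‹_›
    · exact self rfl rfl .test
  case leave u n =>
    cases h
    refine .propose u u _ _ rfl rfl (.laps n) ?_
    convert ProposeStep.leave using 1
    simp only [Consensus.snap, Snap.mk.injEq, true_and]
    ext q
    by_cases hq : q = p
    · subst hq; simp
    · simp [hq]
  case race u n =>
    cases h
    have := maxLap_spec hB t
    exact self rfl rfl (.race this.1 this.2)
  case splitSetX u n =>
    cases h
    refine .propose u u _ _ rfl rfl (.graf n _ (.inr rfl) (.inl rfl) (.inl rfl) (.inl rfl)) ?_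
    convert ProposeStep.splitSetX using 1
    simp only [Consensus.snap, Snap.mk.injEq]
    refine ⟨?_, ?_, ?_, ?_, trivial⟩ <;> ext1 k <;> by_cases hk : k = n <;> simp [hk]
  case splitGetY u n =>
    split at h <;> cases h
    · exact self rfl rfl (.closed ‹_›)
    · exact self rfl rfl (.opened (Bool.eq_false_of_not_eq_true ‹_›))
  case splitSetY u n =>
    cases h
    refine .propose u u _ _ rfl rfl (.graf n _ (.inl rfl) (.inr rfl) (.inl rfl) (.inl rfl)) ?_
    convert ProposeStep.splitSetY using 1
    simp only [Consensus.snap, Snap.mk.injEq]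
    refine ⟨?_, ?_, ?_, ?_, trivial⟩ <;> ext1 k <;> by_cases hk : k = n <;> simp [hk]
  case splitGetX u n =>
    split at h <;> cases h
    · exact self rfl rfl (.win ‹_›)
    · exact self rfl rfl .lose
  case loseSetC u n =>
    cases h
    refine .propose u u _ _ rfl rfl (.graf n _ (.inl rfl) (.inl rfl) (.inr rfl) (.inl rfl)) ?_
    convert ProposeStep.loseSetC using 1
    simp only [Consensus.snap, Snap.mk.injEq]
    refine ⟨?_, ?_, ?_, ?_, trivial⟩ <;> ext1 k <;> by_cases hk : k = n <;> simp [hk]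
  case loseGetD u n =>
    split at h <;> cases h
    · exact self rfl rfl (.adopt ‹_›)
    · exact self rfl rfl (.empty ‹_›)
  case loseSetD u n =>
    cases h
    refine .propose u u _ _ rfl rfl (.graf n _ (.inl rfl) (.inl rfl) (.inl rfl) (.inr rfl)) ?_
    convert ProposeStep.loseSetD using 1
    simp only [Consensus.snap, Snap.mk.injEq]
    refine ⟨?_, ?_, ?_, ?_, trivial⟩ <;> ext1 k <;> by_cases hk : k = n <;> simp [hk]
  case winSetD u n =>
    cases h
    refine .propose u u _ _ rfl rfl (.graf n _ (.inl rfl) (.inl rfl) (.inl rfl) (.inr rfl)) ?_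
    convert ProposeStep.winSetD using 1
    simp only [Consensus.snap, Snap.mk.injEq]
    refine ⟨?_, ?_, ?_, ?_, trivial⟩ <;> ext1 k <;> by_cases hk : k = n <;> simp [hk]
  case winGetC u n =>
    split at h <;> cases h
    · exact self rfl rfl (.contended ‹_›)
    · exact self rfl rfl (.commit (Bool.eq_false_of_not_eq_true ‹_›))
  case decide u => cases h; exact .decide u rfl
  case ret v => cases h; exact .ret v rfl

/-! ### Bounds on timestamps and indices, and recycling -/

/-- The writes of all rounds are prior to round `M`, only finitely many laps were entered, and
every value comes with a timestamp that is greater than that of the register where it is. -/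
structure _root_.Consensus.WF (o : Consensus P (Decision P S)) (M : ℕ) : Prop where
  d_ts : o.d.ts < M
  laps_ts : ∀ q, (o.laps q).ts < M
  graf_ts : ∀ n, (o.graf n).x.ts < M ∧ (o.graf n).y.ts < M ∧ (o.graf n).c.ts < M ∧
    (o.graf n).d.ts < M
  graf : ∃ K, ∀ n, K ≤ n → o.graf n = Grafarius.init P (Decision P S)
  laps : ∃ B, ∀ q, (o.laps q).val ≤ B
  d : ∀ w, o.d.val = some w → o.d.ts < w.ts
  graf_d : ∀ n w, (o.graf n).d.val = some w → (o.graf n).d.ts < w.ts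

theorem _root_.Consensus.WF.mono {o : Consensus P (Decision P S)} {M M' : ℕ} (h : o.WF M)
    (hM : M ≤ M') : o.WF M' where
  d_ts := h.d_ts.trans_le hM
  laps_ts q := (h.laps_ts q).trans_le hM
  graf_ts n := by have := h.graf_ts n; omega
  graf := h.graf
  laps := h.laps
  d := h.d
  graf_d := h.graf_d

theorem _root_.Consensus.wf_init : (Consensus.init P (Decision P S)).WF 1 := by
  constructor <;> simp [Consensus.init, Grafarius.init]

theorem _root_.Consensus.WF.writes {p : P} {t M : ℕ} {u : Decision P S}
    {o o' : Consensus P (Decision P S)} (h : o.WF M) (hw : o.Writes p t u o') (ht : t < M)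
    (hu : t < u.ts) : o'.WF M := by
  cases hw with
  | refl => exact h
  | laps n =>
    refine ⟨h.d_ts, fun q => ?_, h.graf_ts, h.graf, ?_, h.d, h.graf_d⟩
    · have := h.laps_ts q
      by_cases hq : q = p
      · subst hq; simpa
      · simpa [hq]
    · obtain ⟨B, hB⟩ := h.laps
      refine ⟨max B n, fun q => ?_⟩
      have := hB q
      by_cases hq : q = p
      · subst hq; simp
      · simp [hq, this]
  | graf n g hx hy hc hd =>
    refine ⟨h.d_ts, h.laps_ts, fun k => ?_, ?_, h.laps, h.d, fun k w => ?_⟩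
    · have := h.graf_ts k
      by_cases hk : k = n
      · subst hk
        simp only [Function.update_self]
        refine ⟨by omega, by omega, by omega, ?_⟩
        rcases hd with hd | hd <;> simp [*]
      · simpa [hk]
    · obtain ⟨K, hK⟩ := h.graf
      refine ⟨max K (n + 1), fun k hk => ?_⟩
      have : k ≠ n := by omega
      simpa [this] using hK k (by omega)
    · have := h.graf_d k w
      by_cases hk : k = n
      · subst hk
        simp only [Function.update_self]
        rcases hd with hd | hd <;> simp only [hd]
        · exact this
        · simp; grind
      · simpa [hk]

theorem _root_.Consensus.WF.decide {t M : ℕ} {u : Decision P S}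
    {o : Consensus P (Decision P S)} (h : o.WF M) (ht : t < M) (hu : t < u.ts) :
    Consensus.WF { o with d := ⟨t, some u⟩ } M where
  d_ts := ht
  laps_ts := h.laps_ts
  graf_ts := h.graf_ts
  graf := h.graf
  laps := h.laps
  d := by rintro w ⟨⟩; exact hu
  graf_d := h.graf_d

def Mem.WF (m : Mem P S) (M : ℕ) : Prop := ∀ k, (m.cons k).WF M

theorem Mem.WF.setCons {m : Mem P S} {M k : ℕ} {o : Consensus P (Decision P S)} (h : m.WF M)
    (ho : o.WF M) : (m.setCons k o).WF M := by
  intro j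
  by_cases hj : j = k
  · subst hj; simpa [Mem.setCons]
  · simpa [Mem.setCons, hj] using h j

theorem _root_.Stamped.read_eq_some {α : Type*} {r : Stamped (Option α)} {t : ℕ} {w : α} :
    r.read none t = some w ↔ t ≤ r.ts ∧ r.val = some w := by
  simp only [Stamped.read]
  split
  · simp; omega
  · simp; omega

theorem finite_participants (h : List (Event P O R)) : (participants h).Finite := by
  have hf : Set.Finite {e | e ∈ h} := h.finite_toSet
  refine (hf.preimage (f := fun x : P × O => Event.inv x.1 x.2) ?_).image Prod.fst |>.subset ?_
  · rintro ⟨p, o⟩ - ⟨p', o'⟩ - heq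
    simpa using heq
  · rintro p ⟨o, ho⟩
    exact ⟨(p, o), ho, rfl⟩

/-- Pigeonhole: each process of `A` occupies at most one index. -/
theorem freeIndex_spec {A : Set P} (hA : A.Finite) {L : P → Option ℕ}
    (hL : ∀ q k, L q = some k → q ∈ A) :
    freeIndex L ≤ A.ncard ∧ ∀ q, L q ≠ some (freeIndex L) := by
  classical
  have hne : ∃ k ≤ A.ncard, ∀ q, L q ≠ some k := by
    by_contra! hall
    -- Choosing an owner in `L` for each index up to `A.ncard` would inject `A.ncard + 1` indices
    -- into `A`.
    choose f hf using fun k : Finset.range (A.ncard + 1) =>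
      hall k (by have := Finset.mem_range.1 k.2; omega)
    have hinj : Function.Injective f := fun a b hab => by
      have h1 := hf a
      rw [hab, hf b] at h1
      exact Subtype.ext (Option.some.inj h1).symm
    have := Finset.card_le_card_of_injOn (s := Finset.univ) (t := hA.toFinset) f
      (fun k _ => by simpa using hL _ _ (hf k)) hinj.injOn
    rw [← Set.ncard_eq_toFinset_card A hA] at this
    simp at this
  obtain ⟨k, hk, hk'⟩ := hne
  have hmem : k ∈ {k | ∀ q, L q ≠ some k} := hk'
  exact ⟨(Nat.sInf_le hmem).trans hk, Nat.sInf_mem ⟨k, hmem⟩⟩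

/-- The indices in a consensus object are at most `K`. -/
structure _root_.Consensus.IdxLE (o : Consensus P (Decision P S)) (K : ℕ) : Prop where
  d : ∀ w, o.d.val = some w → w.idx ≤ K
  graf_d : ∀ n w, (o.graf n).d.val = some w → w.idx ≤ K

theorem _root_.Consensus.IdxLE.writes {p : P} {t K : ℕ} {u : Decision P S}
    {o o' : Consensus P (Decision P S)} (h : o.IdxLE K) (hw : o.Writes p t u o')
    (hu : u.idx ≤ K) : o'.IdxLE K := by
  cases hw with
  | refl => exact h
  | laps n => exact ⟨h.d, h.graf_d⟩
  | graf n g hx hy hc hd =>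
    refine ⟨h.d, fun k w => ?_⟩
    have := h.graf_d k w
    by_cases hk : k = n
    · subst hk
      simp only [Function.update_self]
      rcases hd with hd | hd <;> simp only [hd]
      · exact this
      · simp; grind
    · simpa [hk]

/-- What is known of the processes and of the memory, for a finite set `A` of participants. -/
structure Basic (A : Set P) (m : Mem P S) (proc : P → View S ⊕ Run P S O R) : Prop where
  run : ∀ q r, proc q = .inr r → q ∈ A
  L : ∀ q k, m.L q = some k → q ∈ A
  index : ∀ q, index (proc q) ≤ A.ncard
  est : ∀ q r u, proc q = .inr r → r.pc.est = some u → u.idx ≤ A.ncard ∧ r.view.t < u.ts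
  wf : ∃ M, m.WF M
  idx : ∀ k, (m.cons k).IdxLE A.ncard
  unused : ∀ k, A.ncard < k → m.cons k = Consensus.init P (Decision P S)

theorem ProposeStep.est {p : P} {σ σ' : Snap P (Decision P S)} {pc pc' : PC P S R}
    (h : ProposeStep p σ pc σ' pc') {u u' : Decision P S} (hu : pc.est = some u)
    (hu' : pc'.est = some u') : u' = u ∨ ∃ n, σ.d n = some u' := by
  cases h <;> simp only [PC.est] at * <;> grind

theorem proposed_est (T : SeqType S O R) (p : P) (r : Run P S O R) (w : Decision P S) :
    (proposed T p r w).est = none := by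
  unfold proposed; split <;> rfl

open Classical in
-- Only `start` creates an index, by `freeIndex`; every other index is copied from an estimate or
-- from memory, where the bound already holds.
theorem Basic.move {A : Set P} (hA : A.Finite) {T : SeqType S O R} {p : P} {m m' : Mem P S}
    {r : Run P S O R} {x : Run P S O R ⊕ (View S × R)} {proc : P → View S ⊕ Run P S O R}
    (h : Basic A m proc) (hp : proc p = .inr r) (hm : Move T p m r m' x) :
    Basic A m' (Function.update proc p (x.elim .inr fun y => .inl y.1)) := by
  have hpA := h.run p r hp
  have hidx := h.index p
  rw [hp] at hidx
  have hidx : r.view.l ≤ A.ncard := hidx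
  have key : (∀ q k, m'.L q = some k → q ∈ A) ∧
      Buniv.index (x.elim Sum.inr fun y => .inl y.1) ≤ A.ncard ∧
      (∀ r' u, x = .inl r' → r'.pc.est = some u → u.idx ≤ A.ncard ∧ r'.view.t < u.ts) ∧
      (∃ M, m'.WF M) ∧ (∀ k, (m'.cons k).IdxLE A.ncard) ∧
      ∀ k, A.ncard < k → m'.cons k = Consensus.init P (Decision P S) := by
    have hset : ∀ o, (∀ M, (m.cons r.view.l).WF M → r.view.t < M → o.WF M) →
        o.IdxLE A.ncard → (∃ M, (m.setCons r.view.l o).WF M) ∧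
        (∀ k, ((m.setCons r.view.l o).cons k).IdxLE A.ncard) ∧
        ∀ k, A.ncard < k → (m.setCons r.view.l o).cons k = Consensus.init P (Decision P S) := by
      intro o ho ho'
      refine ⟨?_, fun k => ?_, fun k hk => ?_⟩
      · obtain ⟨M, hM⟩ := h.wf
        -- The bound has to exceed the round in which the write takes place.
        have hM' : m.WF (max M (r.view.t + 1)) := fun k => (hM k).mono (le_max_left _ _)
        exact ⟨_, hM'.setCons (ho _ (hM' _) (by omega))⟩
      · by_cases hk : k = r.view.l
        · subst hk; simpa [Mem.setCons]
        · simpa [Mem.setCons, hk] using h.idx k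
      · have : k ≠ r.view.l := by omega
        simpa [Mem.setCons, this] using h.unused k hk
    cases hm with
    | enter hpc =>
      refine ⟨fun q k => ?_, hidx, ?_, h.wf, h.idx, h.unused⟩
      · by_cases hq : q = p
        · subst hq; exact fun _ => hpA
        · simpa [hq] using h.L q k
      · rintro _ u ⟨⟩ hu; simp [PC.est] at hu
    | jump w hpc hw =>
      refine ⟨h.L, (h.idx _).d w (Stamped.read_eq_some.1 hw).2, ?_, h.wf, h.idx, h.unused⟩
      rintro _ u ⟨⟩ hu; simp [PC.est] at hu
    | read | free =>
      refine ⟨h.L, hidx, ?_, h.wf, h.idx, h.unused⟩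
      rintro _ u ⟨⟩ hu; simp [PC.est] at hu
    | start hpc =>
      refine ⟨h.L, hidx, ?_, h.wf, h.idx, h.unused⟩
      rintro _ u ⟨⟩ hu
      cases hu
      exact ⟨(freeIndex_spec hA h.L).1, by simp⟩
    | decided u n w hpc hw =>
      refine ⟨h.L, hidx, ?_, h.wf, h.idx, h.unused⟩
      rintro _ u ⟨⟩ hu; simp [proposed_est] at hu
    | propose u u' o pc hpc hpc' hw hs =>
      have hu := h.est p r u hp hpc
      refine ⟨h.L, hidx, ?_, hset o (fun M hM ht => hM.writes hw ht hu.2) ((h.idx _).writes hw hu.1)⟩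
      rintro _ v ⟨⟩ hv
      rcases ProposeStep.est hs hpc hv with rfl | ⟨n, hn⟩
      · exact hu
      -- An adopted value was visible in this round, so the stamp of its register is at least the
      -- round, and its own timestamp is greater still.
      · obtain ⟨h1, h2⟩ := Stamped.read_eq_some.1 hn
        obtain ⟨M, hM⟩ := h.wf
        exact ⟨(h.idx _).graf_d n v h2, h1.trans_lt ((hM _).graf_d n v h2)⟩
    | decide u hpc =>
      have hu := h.est p r u hp (by rw [hpc]; rfl)
      refine ⟨h.L, hidx, ?_, hset _ (fun M hM ht => hM.decide ht hu.2)
        ⟨by rintro w ⟨⟩; exact hu.1, (h.idx _).graf_d⟩⟩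
      rintro _ v ⟨⟩ hv; simp [proposed_est] at hv
    | ret v hpc =>
      exact ⟨h.L, hidx, by simp, h.wf, h.idx, h.unused⟩
  obtain ⟨h1, h2, h3, h4, h5, h6⟩ := key
  refine ⟨fun q r' hq => ?_, h1, fun q => ?_, fun q r' u hq => ?_, h4, h5, h6⟩
  all_goals by_cases hqp : q = p
  · subst hqp; exact hpA
  · rw [Function.update_of_ne hqp] at hq; exact h.run q r' hq
  · subst hqp; simpa using h2
  · simpa [hqp] using h.index q
  · subst hqp
    refine h3 r' u ?_
    cases x <;> simp_all
  · rw [Function.update_of_ne hqp] at hq; exact h.est q r' u hq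

theorem Basic.mono {A B : Set P} (hB : B.Finite) (hAB : A ⊆ B) {m : Mem P S}
    {proc : P → View S ⊕ Run P S O R} (h : Basic A m proc) : Basic B m proc := by
  have hc := Set.ncard_le_ncard hAB hB
  exact ⟨fun q r hq => hAB (h.run q r hq), fun q k hq => hAB (h.L q k hq),
    fun q => (h.index q).trans hc, fun q r u hq hu => by have := h.est q r u hq hu; omega, h.wf,
    fun k => ⟨fun w hw => ((h.idx k).d w hw).trans hc,
      fun n w hw => ((h.idx k).graf_d n w hw).trans hc⟩, fun k hk => h.unused k (by omega)⟩

theorem participants_append (h : List (Event P O R)) (e : List (Event P O R)) :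
    participants h ⊆ participants (h ++ e) := fun _ ⟨o, ho⟩ => ⟨o, by simp [ho]⟩

open Classical in
theorem Basic.reach {T : SeqType S O R} {h : List (Event P O R)}
    {c : (algorithm P T).Config} (hr : (algorithm P T).Reach h c) :
    Basic (participants h) c.mem c.proc := by
  have hmove : ∀ {h : List (Event P O R)} {c : (algorithm P T).Config} {p : P} {r : Run P S O R}
      {m : Mem P S} {x}, Basic (participants h) c.mem c.proc → c.proc p = .inr r →
      step T p c.mem r = (m, x) →
      Basic (participants h) m (Function.update c.proc p (x.elim .inr fun y => .inl y.1)) := by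
    intro h c p r m x ih hp hs
    obtain ⟨M, hM⟩ := ih.wf
    exact ih.move (finite_participants h) hp (Move.of_step hs (hM _).laps)
  induction hr with
  | init =>
    constructor <;> simp [algorithm, Implementation.initial, Buniv.index]
    · exact ⟨1, fun k => Consensus.wf_init⟩
    · constructor <;> simp [Consensus.init, Grafarius.init]
  | @invoke h c p o i hr hp ih =>
    have ih := ih.mono (finite_participants _) (participants_append h [.inv p o])
    refine ⟨fun q r hq => ?_, ih.L, fun q => ?_, fun q r u hq => ?_, ih.wf, ih.idx, ih.unused⟩
    all_goals by_cases hqp : q = p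
    · subst hqp; exact ⟨o, by simp⟩
    · exact ih.run q r (by simpa [Implementation.Config.move, hqp] using hq)
    · subst hqp
      have := ih.index q
      rw [hp] at this
      simp only [Implementation.Config.move, Function.update_self]
      exact this
    · simpa [Implementation.Config.move, hqp] using ih.index q
    · subst hqp
      simp only [Implementation.Config.move, Function.update_self] at hq
      cases hq
      simp [PC.est, algorithm]
    · exact ih.est q r u (by simpa [Implementation.Config.move, hqp] using hq)
  | step p r r' m hr hp hs ih => exact hmove ih hp hs
  | respond p r m i v hr hp hs ih =>
    exact (hmove ih hp hs).mono (finite_participants _) (participants_append _ _)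

theorem recyclesConsensus (P : Type*) {S O R : Type*} (T : SeqType S O R) :
    RecyclesConsensus P T := fun _ _ hr => ⟨(Basic.reach hr).index, (Basic.reach hr).unused⟩

/-! ### Obstruction-freedom -/

section Solo

variable {T : SeqType S O R} {p : P} {m : Mem P S} {v : View S} {op : O}

/-- Running alone, `p` completes its operation. -/
abbrev Solo (T : SeqType S O R) (p : P) (m : Mem P S) (r : Run P S O R) : Prop :=
  (algorithm P T).CompletesSolo p m r

theorem Solo.of_step {r : Run P S O R}
    (h : ∀ m' r', step T p m r = (m', .inl r') → Solo T p m' r') : Solo T p m r := by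
  rcases hs : step T p m r with ⟨m', r' | x⟩
  · exact .more m' r' hs (h m' r' hs)
  · exact .done m' x hs

theorem Solo.ret {x : R} : Solo T p m ⟨v, op, .ret x⟩ :=
  .of_step fun m' r' h => by simp [step] at h

theorem Solo.proposed_self {w : Decision P S} {r : Run P S O R} (hw : w.proc = p) :
    Solo T p m ⟨v, op, proposed T p r w⟩ := by
  rw [proposed, if_pos hw]; exact .ret

theorem Mem.WF.setGraf {M n : ℕ} {u : Decision P S} {g : Grafarius P (Decision P S)} (h : m.WF M)
    (ht : v.t < M) (hu : v.t < u.ts) (hx : g.x.ts = ((m.cons v.l).graf n).x.ts ∨ g.x.ts = v.t)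
    (hy : g.y.ts = ((m.cons v.l).graf n).y.ts ∨ g.y.ts = v.t)
    (hc : g.c.ts = ((m.cons v.l).graf n).c.ts ∨ g.c.ts = v.t)
    (hd : g.d = ((m.cons v.l).graf n).d ∨ g.d = ⟨v.t, some u⟩) : (m.setGraf v.l n g).WF M := by
  intro k
  by_cases hk : k = v.l
  · subst hk
    by_cases hP : Nonempty P
    · obtain ⟨p⟩ := hP
      exact h.setCons ((h _).writes (p := p) (.graf n g hx hy hc hd) ht hu) _
    · exact (hP ⟨u.proc⟩).elim
  · simpa [Mem.setGraf, Mem.setCons, hk] using h k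

theorem Mem.setGraf_cons (m : Mem P S) (k n : ℕ) (g : Grafarius P (Decision P S)) :
    (m.setGraf k n g).cons k = { m.cons k with graf := Function.update (m.cons k).graf n g } := by
  simp [Mem.setGraf, Mem.setCons]

/-- Running alone in a lap that no process entered, `p` commits its estimate. -/
theorem Solo.commit {M n : ℕ} {u : Decision P S} (hm : m.WF M) (ht : v.t < M) (hu : v.t < u.ts)
    (hy : ((m.cons v.l).graf n).y.read false v.t = false)
    (hc : ((m.cons v.l).graf n).c.read false v.t = false)
    (hdec : ∀ m', m'.WF M → Solo T p m' ⟨v, op, .decide u⟩) :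
    Solo T p m ⟨v, op, .splitSetX u n⟩ := by
  refine .of_step fun m₁ r₁ h => ?_
  cases h
  refine .of_step fun m₂ r₂ h => ?_
  simp only [step, Mem.setGraf_cons, Function.update_self, hy] at h
  cases h
  refine .of_step fun m₃ r₃ h => ?_
  cases h
  refine .of_step fun m₄ r₄ h => ?_
  simp only [step, Mem.setGraf_cons, Function.update_self, Stamped.read_self, if_true] at h
  cases h
  refine .of_step fun m₅ r₅ h => ?_
  cases h
  refine .of_step fun m₆ r₆ h => ?_
  simp only [step, Mem.setGraf_cons, Function.update_self, hc] at h
  cases h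
  apply hdec
  have h1 : ∀ {m : Mem P S}, m.WF M → (m.setGraf v.l n
      { (m.cons v.l).graf n with x := ⟨v.t, some p⟩ }).WF M := fun h =>
    h.setGraf ht hu (.inr rfl) (.inl rfl) (.inl rfl) (.inl rfl)
  have h2 : ∀ {m : Mem P S}, m.WF M → (m.setGraf v.l n
      { (m.cons v.l).graf n with y := ⟨v.t, true⟩ }).WF M := fun h =>
    h.setGraf ht hu (.inl rfl) (.inr rfl) (.inl rfl) (.inl rfl)
  have h3 : ∀ {m : Mem P S}, m.WF M → (m.setGraf v.l n
      { (m.cons v.l).graf n with d := ⟨v.t, some u⟩ }).WF M := fun h =>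
    h.setGraf ht hu (.inl rfl) (.inl rfl) (.inl rfl) (.inr rfl)
  simpa [Mem.setGraf_cons] using h3 (h2 (h1 hm))

/-- The memory is well-formed, and no process entered the laps from `K` on of `F l`. -/
def Mem.Bounded (m : Mem P S) (l M K : ℕ) : Prop :=
  m.WF M ∧ ∀ k, K ≤ k → (m.cons l).graf k = Grafarius.init P (Decision P S)

theorem Mem.Bounded.setGraf {M K n : ℕ} {u : Decision P S} {g : Grafarius P (Decision P S)}
    (h : m.Bounded v.l M K) (ht : v.t < M) (hn : n < K) (hu : v.t < u.ts)
    (hx : g.x.ts = ((m.cons v.l).graf n).x.ts ∨ g.x.ts = v.t)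
    (hy : g.y.ts = ((m.cons v.l).graf n).y.ts ∨ g.y.ts = v.t)
    (hc : g.c.ts = ((m.cons v.l).graf n).c.ts ∨ g.c.ts = v.t)
    (hd : g.d = ((m.cons v.l).graf n).d ∨ g.d = ⟨v.t, some u⟩) :
    (m.setGraf v.l n g).Bounded v.l M K := by
  refine ⟨h.1.setGraf ht hu hx hy hc hd, fun k hk => ?_⟩
  have : k ≠ n := by omega
  simpa [Mem.setGraf_cons, this] using h.2 k hk

/-- The program counters in lap `n`, with a measure of the distance to the end of the lap. -/
def PC.lapRank : PC P S R → Option (ℕ × ℕ × Decision P S)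
  | .splitSetX u n => some (n, 9, u)
  | .splitGetY u n => some (n, 8, u)
  | .splitSetY u n => some (n, 7, u)
  | .splitGetX u n => some (n, 6, u)
  | .loseSetC u n => some (n, 5, u)
  | .loseGetD u n => some (n, 4, u)
  | .loseSetD u n => some (n, 3, u)
  | .winSetD u n => some (n, 2, u)
  | .winGetC u n => some (n, 1, u)
  | _ => none

/-- Running alone in a lap, `p` reaches its end. -/
theorem Solo.lap {M K n i : ℕ} {u : Decision P S} {pc : PC P S R} (hm : m.Bounded v.l M K)
    (ht : v.t < M) (hn : n < K) (hu : v.t < u.ts) (hpc : pc.lapRank = some (n, i, u))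
    (htest : ∀ m' w, m'.Bounded v.l M K → v.t < w.ts → Solo T p m' ⟨v, op, .test w n⟩)
    (hdec : ∀ m' w, m'.Bounded v.l M K → v.t < w.ts → Solo T p m' ⟨v, op, .decide w⟩) :
    Solo T p m ⟨v, op, pc⟩ := by
  induction i using Nat.strong_induction_on generalizing m pc with
  | _ i ih =>
  refine .of_step fun m' r' h => ?_
  cases pc <;> simp only [PC.lapRank, reduceCtorEq, Option.some.injEq, Prod.mk.injEq] at hpc <;>
    obtain ⟨rfl, rfl, rfl⟩ := hpc
  case splitSetX =>
    cases h
    exact ih 8 (by omega) (hm.setGraf ht hn hu (.inr rfl) (.inl rfl) (.inl rfl) (.inl rfl)) rfl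
  case splitGetY =>
    simp only [step] at h
    split at h <;> cases h
    · exact ih 5 (by omega) hm rfl
    · exact ih 7 (by omega) hm rfl
  case splitSetY =>
    cases h
    exact ih 6 (by omega) (hm.setGraf ht hn hu (.inl rfl) (.inr rfl) (.inl rfl) (.inl rfl)) rfl
  case splitGetX =>
    simp only [step] at h
    split at h <;> cases h
    · exact ih 2 (by omega) hm rfl
    · exact ih 5 (by omega) hm rfl
  case loseSetC =>
    cases h
    exact ih 4 (by omega) (hm.setGraf ht hn hu (.inl rfl) (.inl rfl) (.inr rfl) (.inl rfl)) rfl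
  case loseGetD =>
    simp only [step] at h
    split at h <;> cases h
    · rename_i w hw
      obtain ⟨h1, h2⟩ := Stamped.read_eq_some.1 hw
      exact htest _ _ hm (h1.trans_lt ((hm.1 _).graf_d _ _ h2))
    · exact ih 3 (by omega) hm rfl
  case loseSetD =>
    cases h
    exact htest _ _ (hm.setGraf ht hn hu (.inl rfl) (.inl rfl) (.inl rfl) (.inr rfl)) hu
  case winSetD =>
    cases h
    exact ih 1 (by omega) (hm.setGraf ht hn hu (.inl rfl) (.inl rfl) (.inl rfl) (.inr rfl)) rfl
  case winGetC =>
    simp only [step] at h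
    split at h <;> cases h
    · exact htest _ _ hm hu
    · exact hdec _ _ hm hu

theorem Mem.Bounded.leave {M K n : ℕ} {u : Decision P S} (h : m.Bounded v.l M K) (ht : v.t < M)
    (hu : v.t < u.ts) : ((step T p m ⟨v, op, .leave u n⟩).1).Bounded v.l M K := by
  refine ⟨h.1.setCons ((h.1 _).writes (.laps n) ht hu), fun k hk => ?_⟩
  simpa [Mem.setCons, step] using h.2 k hk

open Classical in
-- As `p` has just published `n`, the maximum is at least `n`, and in case of equality the race adds
-- one.
theorem race_lt [Nonempty P] {laps : P → Stamped ℕ} (h : ∃ B, ∀ q, (laps q).val ≤ B) {t n : ℕ}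
    (hn : (laps p).read 0 t = n) : n < if maxLap laps t = n then n + 1 else maxLap laps t := by
  have := (maxLap_spec h t).1 p
  split <;> omega

/-- Running alone in a call to `propose`, `p` eventually obtains a decision. -/
theorem Solo.test {M K n : ℕ} {u : Decision P S} (hm : m.Bounded v.l M K) (ht : v.t < M)
    (hu : v.t < u.ts)
    (hprop : ∀ m' w pc, m'.WF M → (m'.cons v.l).d.read none v.t = some w →
      Solo T p m' ⟨v, op, proposed T p ⟨v, op, pc⟩ w⟩)
    (hdec : ∀ m' w, m'.WF M → v.t < w.ts → Solo T p m' ⟨v, op, .decide w⟩) :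
    Solo T p m ⟨v, op, .test u n⟩ ∧ Solo T p m ⟨v, op, .leave u n⟩ := by
  have : Nonempty P := ⟨p⟩
  -- Laps below `K` are finitely many and each race moves to a greater one; writes in laps below `K`
  -- keep `K` valid.
  induction hj : K - n using Nat.strong_induction_on generalizing m u n with
  | _ j ih =>
  have hleave : Solo T p m ⟨v, op, .leave u n⟩ := by
    refine .of_step fun m₁ r₁ h => ?_
    have hm₁ := hm.leave (T := T) (p := p) (op := op) (n := n) ht hu
    rw [h] at hm₁
    cases h
    refine .of_step fun m₂ r₂ h => ?_
    cases h
    have hlt := race_lt (p := p) (n := n) (t := v.t) (hm₁.1 v.l).laps (by simp [Mem.setCons])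
    dsimp only at hm₁ hlt ⊢
    generalize (if maxLap _ _ = n then n + 1 else maxLap _ _) = k at *
    by_cases hk : k < K
    · exact .lap hm₁ ht hk hu rfl
        (fun m' w hm' hw => (ih (K - k) (by omega) hm' hw rfl).1) fun m' w hm' hw => hdec m' w hm'.1 hw
    · have hg := hm₁.2 k (by omega)
      refine .commit hm₁.1 ht hu ?_ ?_ fun m' hm' => hdec m' u hm' hu
      all_goals rw [hg]; exact ite_self _
  refine ⟨.of_step fun m₁ r₁ h => ?_, hleave⟩
  simp only [step] at h
  split at h <;> cases h
  · exact hprop _ _ _ hm.1 ‹_›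
  · exact hleave

/-- Running alone from the beginning of a new round, `p` completes its operation. -/
theorem Solo.new_round {M : ℕ} (hm : m.WF M) (ht : M ≤ v.t) : Solo T p m ⟨v, op, .enter⟩ := by
  have : Nonempty P := ⟨p⟩
  refine .of_step fun m₁ r₁ h => ?_
  cases h
  generalize hm₁ : ({ m with L := _ } : Mem P S) = m₁
  have hm₁ : m₁.WF M := by subst hm₁; exact hm
  clear hm
  have hd : (m₁.cons v.l).d.read none v.t = none := by
    have := (hm₁ v.l).d_ts
    simp only [Stamped.read, ite_eq_left_iff]
    omega
  refine .of_step fun m₂ r₂ h => ?_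
  simp only [step, hd] at h
  split at h <;> cases h
  · exact .ret
  refine .of_step fun m₃ r₃ h => ?_
  cases h
  refine .of_step fun m₄ r₄ h => ?_
  simp only [step, hd] at h
  cases h
  refine .of_step fun m₅ r₅ h => ?_
  cases h
  refine .of_step fun m₆ r₆ h => ?_
  cases h
  have hm₂ : m₁.WF (v.t + 1) := fun k => (hm₁ k).mono (by omega)
  -- Whatever lap the race yields, its registers are stamped before this round and read as initial.
  refine .commit (M := v.t + 1) (hm₂.setCons ((hm₂ _).writes
    (u := ⟨(T.τ v.s op).1, p, freeIndex m₁.L, v.t + 1⟩) (.laps 0) (by simp) (by simp))) (by simp) (by simp) ?_ ?_ fun m' _ => ?_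
  · have := ((hm₁ v.l).graf_ts)
    simp [Mem.setCons, Stamped.read]
    grind
  · have := ((hm₁ v.l).graf_ts)
    simp [Mem.setCons, Stamped.read]
    grind
  · refine .of_step fun m₇ r₇ h => ?_
    cases h
    exact .proposed_self rfl

/-- Induction on `M - t`. Writes in rounds below `M` keep the bound `M`, and a decision visible in
round `t` leads to a later round. A jump may land at `M` or beyond, always at `enter`, whence the
first alternative; there `Solo.new_round` concludes. -/
theorem Solo.of_wf {M : ℕ} {r : Run P S O R} (hm : m.WF M)
    (hr : r.pc = .enter ∨ r.view.t < M ∧ ∀ u, r.pc.est = some u → r.view.t < u.ts) :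
    Solo T p m r := by
  have : Nonempty P := ⟨p⟩
  induction hj : M - r.view.t using Nat.strong_induction_on generalizing m r with
  | _ j ih =>
  obtain ⟨v, op, pc⟩ := r
  dsimp only at hr hj
  by_cases ht : v.t < M
  swap
  · rcases hr with rfl | hr
    · exact .new_round hm (by omega)
    · exact (ht hr.1).elim
  have hjump : ∀ m w, m.WF M → (m.cons v.l).d.read none v.t = some w →
      Solo T p m ⟨⟨w.state, w.idx, w.ts⟩, op, .enter⟩ := by
    intro m w hm hw
    obtain ⟨h1, h2⟩ := Stamped.read_eq_some.1 hw
    have := (hm _).d w h2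
    exact ih (M - w.ts) (by omega) hm (.inl rfl) rfl
  have hprop : ∀ m w w' r, m.WF M → (m.cons v.l).d.read none v.t = some w' →
      Solo T p m ⟨v, op, proposed T p r w⟩ := by
    intro m w w' r hm hw
    unfold proposed
    split
    · exact .ret
    refine .of_step fun m₁ r₁ h => ?_
    cases h
    refine .of_step fun m₂ r₂ h => ?_
    simp only [step, hw] at h
    cases h
    -- A process whose proposal was rejected starts over, reads in the same register the decision
    -- that rejected it, and jumps.
    exact hjump _ _ hm hw
  have hdec : ∀ m w, m.WF M → v.t < w.ts → Solo T p m ⟨v, op, .decide w⟩ := by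
    intro m w hm hw
    refine .of_step fun m₁ r₁ h => ?_
    cases h
    exact hprop _ _ w _ (hm.setCons ((hm _).decide ht hw)) (by simp [Mem.setCons])
  have htest : ∀ m u n, m.WF M → v.t < u.ts →
      Solo T p m ⟨v, op, .test u n⟩ ∧ Solo T p m ⟨v, op, .leave u n⟩ := by
    intro m u n hm hu
    obtain ⟨K, hK⟩ := (hm v.l).graf
    exact Solo.test ⟨hm, hK⟩ ht hu (fun m w pc hm hw => hprop m w w _ hm hw) hdec
  have hlap : ∀ m n i u pc, m.WF M → v.t < u.ts → pc.lapRank = some (n, i, u) →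
      Solo T p m ⟨v, op, pc⟩ := by
    intro m n i u pc hm hu hpc
    obtain ⟨K, hK⟩ := (hm v.l).graf
    exact .lap (K := max K (n + 1)) ⟨hm, fun k hk => hK k (by omega)⟩ ht (by omega) hu hpc
      (fun m w hm hw => (htest m w n hm.1 hw).1) fun m w hm hw => hdec m w hm.1 hw
  have hfree : ∀ m, m.WF M → Solo T p m ⟨v, op, .free⟩ := by
    intro m hm
    refine .of_step fun m₁ r₁ h => ?_
    cases h
    exact (htest _ _ _ hm (by simp)).1
  have hcheck : ∀ m, m.WF M → Solo T p m ⟨v, op, .check⟩ := by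
    intro m hm
    refine .of_step fun m₁ r₁ h => ?_
    simp only [step] at h
    split at h
    · cases h
      exact hjump _ _ hm ‹_›
    · split at h <;> cases h
      · exact .ret
      · exact hfree _ hm
  have hest : ∀ u, pc.est = some u → v.t < u.ts := by
    rcases hr with rfl | hr
    · simp [PC.est]
    · exact hr.2
  cases pc
  case enter =>
    refine .of_step fun m₁ r₁ h => ?_
    cases h
    exact hcheck _ hm
  case check => exact hcheck _ hm
  case free => exact hfree _ hm
  case test u n => exact (htest m u n hm (hest _ rfl)).1
  case leave u n => exact (htest m u n hm (hest _ rfl)).2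
  case race u n =>
    refine .of_step fun m₁ r₁ h => ?_
    cases h
    exact hlap _ _ _ _ _ hm (hest _ rfl) rfl
  case decide u => exact hdec _ _ hm (hest _ rfl)
  case ret => exact .ret
  all_goals exact hlap _ _ _ _ _ hm (hest _ rfl) rfl

end Solo

theorem obstructionFree (P : Type*) {S O R : Type*} (T : SeqType S O R) :
    (algorithm P T).ObstructionFree := by
  intro h c hr p r hp
  have hb := Basic.reach hr
  obtain ⟨M, hM⟩ := hb.wf
  exact Solo.of_wf (M := max M (r.view.t + 1)) (fun k => (hM k).mono (le_max_left _ _))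
    (.inr ⟨by omega, fun u hu => (hb.est p r u hp hu).2⟩)

/-! ### The sequence of decisions and the reuse of consensus objects -/

/-- The view of the processes that are in round `i`, when `D` are the decisions of the rounds. -/
def viewOf (T : SeqType S O R) (D : List (Decision P S)) : ℕ → Option (View S)
  | 0 => some ⟨T.init, 0, 0⟩
  | i + 1 => D[i]?.map fun w => ⟨w.state, w.idx, w.ts⟩

/-- Round `i`, whose view is `v`, is the last one to use its consensus object. -/
def Current (T : SeqType S O R) (D : List (Decision P S)) (i : ℕ) (v : View S) : Prop :=
  viewOf T D i = some v ∧ ∀ j v', viewOf T D j = some v' → i < j → v'.l ≠ v.l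

/-- The view of a process, given its local state. -/
def procView : View S ⊕ Run P S O R → View S
  | .inl v => v
  | .inr r => r.view

open Classical in
/-- The program counter of `q`, if `q` is executing `propose` on the consensus object of
index `k`. -/
noncomputable def pcAt (proc : P → View S ⊕ Run P S O R) (k : ℕ) (q : P) : PC P S R :=
  match proc q with
  | .inl _ => .enter
  | .inr r => if r.view.l = k ∧ r.pc.est ≠ none then r.pc else .enter

/-- The process read that its round was undecided, and is still in this round. -/
def PC.Active (pc : PC P S R) : Prop := pc = .free ∨ pc.est ≠ none

/-- The value `w` can be decided in the last round, which is undecided and has view `v`. -/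
structure Valid (T : SeqType S O R) (N : ℕ) (v : View S) (proc : P → View S ⊕ Run P S O R)
    (w : Decision P S) : Prop where
  ts : w.ts = N + 1
  proposer : ∃ r, proc w.proc = .inr r ∧ r.view = v ∧ r.pc.est ≠ none ∧ w.state = (T.τ v.s r.op).1
  idx : ∀ q r, proc q = .inr r → r.pc.Active → r.view.l ≠ w.idx

/-- The invariant of the construction, when `D` are the decisions of the rounds. -/
structure Safe (T : SeqType S O R) (D : List (Decision P S)) (m : Mem P S)
    (proc : P → View S ⊕ Run P S O R) : Prop where
  ts : ∀ i w, D[i]? = some w → w.ts = i + 1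
  view : ∀ q, viewOf T D (procView (proc q)).t = some (procView (proc q))
  wf : m.WF (D.length + 1)
  decided : ∀ i v, i < D.length → viewOf T D i = some v →
    ∃ j w, i ≤ j ∧ D[j]? = some w ∧ (m.cons v.l).d = ⟨j, some w⟩
  written : ∀ k w, (m.cons k).d.val = some w → D[(m.cons k).d.ts]? = some w ∧
    ∃ v, viewOf T D (m.cons k).d.ts = some v ∧ v.l = k
  L : ∀ q r, proc q = .inr r → r.pc = .check ∨ r.pc.Active → m.L q = some r.view.l
  current : ∀ q r, proc q = .inr r → r.pc.Active → Current T D r.view.t r.view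
  inv : ∀ i v, Current T D i v → ((m.cons v.l).snap i).Inv (pcAt proc v.l)
  committed : ∀ i v w, Current T D i v → D[i]? = some w →
    ∃ n, ((m.cons v.l).snap i).Committed (pcAt proc v.l) n w
  valid : ∀ v w, viewOf T D D.length = some v →
    ((m.cons v.l).snap D.length).Uses (pcAt proc v.l) w → Valid T D.length v proc w

section Safety

variable {T : SeqType S O R} {D : List (Decision P S)} {m : Mem P S}
  {proc : P → View S ⊕ Run P S O R}

theorem viewOf_le {i : ℕ} {v : View S} (h : viewOf T D i = some v) : i ≤ D.length := by
  cases i with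
  | zero => omega
  | succ i =>
    simp only [viewOf, Option.map_eq_some_iff] at h
    obtain ⟨w, hw, -⟩ := h
    have := (List.getElem?_eq_some_iff.1 hw).1
    omega

theorem viewOf_append {i : ℕ} (u : Decision P S) (h : i ≤ D.length) :
    viewOf T (D ++ [u]) i = viewOf T D i := by
  cases i with
  | zero => rfl
  | succ i => simp only [viewOf, List.getElem?_append_left (Nat.lt_of_succ_le h)]

theorem viewOf_append_last (u : Decision P S) :
    viewOf T (D ++ [u]) (D.length + 1) = some ⟨u.state, u.idx, u.ts⟩ := by
  simp [viewOf]

theorem Current.unique {i i' : ℕ} {v v' : View S} (h : Current T D i v) (h' : Current T D i' v')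
    (hl : v.l = v'.l) : i = i' ∧ v = v' := by
  have hi : i = i' := by
    rcases lt_trichotomy i i' with hlt | heq | hlt
    · exact (h.2 _ _ h'.1 hlt hl.symm).elim
    · exact heq
    · exact (h'.2 _ _ h.1 hlt hl).elim
  subst hi
  exact ⟨rfl, Option.some.inj (h.1.symm.trans h'.1)⟩

theorem current_last {v : View S} (h : viewOf T D D.length = some v) : Current T D D.length v :=
  ⟨h, fun _ _ h' hlt => absurd (viewOf_le h') (by omega)⟩

/-- In the last round that uses a consensus object, a process reads the decision of this round. -/
theorem Safe.read_iff (hS : Safe T D m proc) {i : ℕ} {v : View S} (h : Current T D i v)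
    {w : Decision P S} : (m.cons v.l).d.read none i = some w ↔ D[i]? = some w := by
  -- The decision found in the register belongs to a round that uses the same object and is not
  -- before `i`; as `i` is the last such round, it is `i`.
  have key : ∀ j, D[j]? ≠ none → i ≤ j → (∃ v', viewOf T D j = some v' ∧ v'.l = v.l) → j = i := by
    rintro j - hij ⟨v', hv', hl⟩
    by_contra hne
    exact h.2 j v' hv' (by omega) hl
  rw [Stamped.read_eq_some]
  constructor
  · rintro ⟨h1, h2⟩
    obtain ⟨h3, h4⟩ := hS.written _ _ h2
    rwa [key _ (by simp [h3]) h1 h4] at h3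
  · intro hw
    obtain ⟨j, w', hij, hj, hd⟩ := hS.decided i v (List.getElem?_eq_some_iff.1 hw).1 h.1
    have := hS.written v.l w' (by rw [hd])
    rw [hd] at this
    obtain rfl := key j (by simp [hj]) hij this.2
    rw [hd]
    exact ⟨le_rfl, by rw [← hj, hw]⟩

theorem Safe.jump (hS : Safe T D m proc) {l t : ℕ} {w : Decision P S}
    (h : (m.cons l).d.read none t = some w) : viewOf T D w.ts = some ⟨w.state, w.idx, w.ts⟩ := by
  obtain ⟨h1, h2⟩ := Stamped.read_eq_some.1 h
  obtain ⟨h3, -⟩ := hS.written _ _ h2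
  rw [hS.ts _ _ h3]
  simp [viewOf, h3, hS.ts _ _ h3]

/-- The object of a decided round keeps the decision of this round or of a later one, and both are
visible in round `i`. Hence reading nothing certifies that the view is up to date. -/
theorem Safe.last_of_read (hS : Safe T D m proc) {i : ℕ} {v : View S} (h : viewOf T D i = some v)
    (hr : (m.cons v.l).d.read none i = none) : i = D.length := by
  by_contra hne
  have := viewOf_le h
  obtain ⟨j, w', hij, hj, hd⟩ := hS.decided i v (by omega) h
  have : ¬ j < i := by omega
  simp [hd, Stamped.read, this] at hr

theorem pcAt_eq {p : P} {r : Run P S O R} (h : proc p = .inr r) (hr : r.pc.est ≠ none) :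
    pcAt proc r.view.l p = r.pc := by
  simp [pcAt, h, hr]

open Classical in
/-- The invariant is preserved by the steps that are not in `propose`. -/
theorem Safe.local_step (hS : Safe T D m proc) {p : P} {x : View S ⊕ Run P S O R}
    {L : P → Option ℕ}
    (hp : ∀ r, proc p = .inr r → r.pc.est = none) (hx : ∀ r, x = .inr r → r.pc.est = none)
    (hL : ∀ q, q ≠ p → L q = m.L q) (hvx : viewOf T D (procView x).t = some (procView x))
    (hx' : ∀ r, x = .inr r → r.pc = .check ∨ r.pc = .free → L p = some r.view.l)
    (hx'' : ∀ r, x = .inr r → r.pc = .free → r.view.t = D.length) :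
    Safe T D { m with L := L } (Function.update proc p x) := by
  -- The process is outside `propose` before and after the step, so no consensus object notices it.
  have hpc : ∀ k, pcAt (Function.update proc p x) k = pcAt proc k := by
    intro k
    funext q
    by_cases hq : q = p
    · subst hq
      have h1 : pcAt (Function.update proc q x) k q = .enter := by
        simp only [pcAt, Function.update_self]
        cases x <;> simp_all
      have h2 : pcAt proc k q = .enter := by
        simp only [pcAt]
        split <;> simp_all
      rw [h1, h2]
    · simp [pcAt, hq]
  have hact : ∀ r, x = .inr r → r.pc.Active → r.pc = .free := by
    rintro r hr (h | h)
    · exact h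
    · exact (h (hx r hr)).elim
  refine ⟨hS.ts, fun q => ?_, hS.wf, hS.decided, hS.written, fun q r hq hr => ?_,
    fun q r hq hr => ?_, fun i v h => ?_, fun i v w h hw => ?_, fun v w hv hw => ?_⟩
  · by_cases hq : q = p
    · subst hq; simpa using hvx
    · simpa [hq] using hS.view q
  · by_cases hqp : q = p
    · subst hqp
      rw [Function.update_self] at hq
      exact hx' r hq (hr.imp_right (hact r hq))
    · rw [Function.update_of_ne hqp] at hq
      exact (hL q hqp).trans (hS.L q r hq hr)
  · by_cases hqp : q = p
    · subst hqp
      rw [Function.update_self] at hq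
      have ht := hx'' r hq (hact r hq hr)
      subst hq
      rw [ht]
      exact current_last (ht ▸ hvx)
    · rw [Function.update_of_ne hqp] at hq
      exact hS.current q r hq hr
  · rw [hpc]; exact hS.inv i v h
  · rw [hpc]; exact hS.committed i v w h hw
  · rw [hpc] at hw
    obtain ⟨h1, ⟨r, h2, h3, h4, h5⟩, h6⟩ := hS.valid v w hv hw
    have hne : w.proc ≠ p := by
      intro h
      exact h4 (hp r (h ▸ h2))
    refine ⟨h1, ⟨r, by rwa [Function.update_of_ne hne], h3, h4, h5⟩, fun q r' hq hr' => ?_⟩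
    by_cases hqp : q = p
    · subst hqp
      rw [Function.update_self] at hq
      have ht := hx'' r' hq (hact r' hq hr')
      subst hq
      -- A process that arrives at `free` is in the last round, like the proposer of `w`, which is
      -- active there; so the index of `w` already avoids theirs.
      have : r'.view = v := by
        have hv' : viewOf T D r'.view.t = some r'.view := hvx
        rw [ht] at hv'
        exact Option.some.inj (hv'.symm.trans hv)
      have := h6 _ r h2 (.inr h4)
      simp_all
    · rw [Function.update_of_ne hqp] at hq
      exact h6 q r' hq hr'

open Classical in
/-- The invariant is preserved by the steps in `propose`. -/
theorem Safe.propose_step (hS : Safe T D m proc) {p : P} {r : Run P S O R} {pc : PC P S R}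
    {o : Consensus P (Decision P S)} (hp : proc p = .inr r) (hr : r.pc.Active)
    (hd : o.d = (m.cons r.view.l).d) (ho : o.WF (D.length + 1))
    (hs : ProposeStep p ((m.cons r.view.l).snap r.view.t) (pcAt proc r.view.l p)
      (o.snap r.view.t) (if pc.est ≠ none then pc else .enter))
    (hend : pc.est ≠ none ∨ r.view.t < D.length)
    (hstart : ∀ w, r.pc.est = none → pc = .test w 0 → w.ts = r.view.t + 1 ∧ w.proc = p ∧
      w.state = (T.τ r.view.s r.op).1 ∧
      (r.view.t = D.length → ∀ q r', proc q = .inr r' → r'.pc.Active → r'.view.l ≠ w.idx)) :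
    Safe T D (m.setCons r.view.l o) (Function.update proc p (.inr { r with pc := pc })) := by
  have hcur := hS.current p r hp hr
  have hat : pcAt (Function.update proc p (.inr { r with pc := pc })) r.view.l =
      Function.update (pcAt proc r.view.l) p (if pc.est ≠ none then pc else .enter) := by
    funext q
    by_cases hq : q = p
    · subst hq; simp [pcAt]
    · simp [pcAt, hq]
  have hat' : ∀ k, k ≠ r.view.l →
      pcAt (Function.update proc p (.inr { r with pc := pc })) k = pcAt proc k := by
    intro k hk
    funext q
    by_cases hq : q = p
    · subst hq; simp [pcAt, hp, hk.symm]
    · simp [pcAt, hq]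
  have hcd : ∀ k, ((m.setCons r.view.l o).cons k).d = (m.cons k).d := by
    intro k
    by_cases hk : k = r.view.l
    · subst hk; simpa [Mem.setCons]
    · simp [Mem.setCons, hk]
  have hself : (m.setCons r.view.l o).cons r.view.l = o := by simp [Mem.setCons]
  have hne : ∀ k, k ≠ r.view.l → (m.setCons r.view.l o).cons k = m.cons k := by
    intro k hk
    simp [Mem.setCons, hk]
  have hI := hS.inv _ _ hcur
  refine ⟨hS.ts, fun q => ?_, hS.wf.setCons ho, by simpa only [hcd] using hS.decided,
    by simpa only [hcd] using hS.written, fun q r' hq hr' => ?_, fun q r' hq hr' => ?_,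
    fun i v h => ?_, fun i v w h hw => ?_, fun v w hv hw => ?_⟩
  · by_cases hq : q = p
    · subst hq
      have := hS.view q
      simpa [hp, procView] using this
    · simpa [hq] using hS.view q
  · by_cases hqp : q = p
    · subst hqp
      simp only [Function.update_self, Sum.inr.injEq] at hq
      subst hq
      exact hS.L q r hp (.inr hr)
    · rw [Function.update_of_ne hqp] at hq
      exact hS.L q r' hq hr'
  · by_cases hqp : q = p
    · subst hqp
      simp only [Function.update_self, Sum.inr.injEq] at hq
      subst hq
      exact hcur
    · rw [Function.update_of_ne hqp] at hq
      exact hS.current q r' hq hr'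
  · by_cases hl : v.l = r.view.l
    · obtain ⟨rfl, rfl⟩ := h.unique hcur hl
      rw [hat, hself]
      exact hI.step hs
    · rw [hat' _ hl, hne _ hl]
      exact hS.inv i v h
  · by_cases hl : v.l = r.view.l
    · obtain ⟨rfl, rfl⟩ := h.unique hcur hl
      rw [hat, hself]
      obtain ⟨n, hn⟩ := hS.committed _ _ _ hcur hw
      exact ⟨n, hn.step hI hs⟩
    · rw [hat' _ hl, hne _ hl]
      exact hS.committed i v w h hw
  · have hrest : (∀ q r', proc q = .inr r' → r'.pc.Active → r'.view.l ≠ w.idx) →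
        ∀ q r', Function.update proc p (.inr { r with pc := pc }) q = .inr r' → r'.pc.Active →
          r'.view.l ≠ w.idx := by
      intro h q r' hq hr'
      by_cases hqp : q = p
      · subst hqp
        simp only [Function.update_self, Sum.inr.injEq] at hq
        subst hq
        exact h q r hp hr
      · rw [Function.update_of_ne hqp] at hq
        exact h q r' hq hr'
    have hold : ((m.cons v.l).snap D.length).Uses (pcAt proc v.l) w →
        Valid T D.length v (Function.update proc p (.inr { r with pc := pc })) w := by
      intro hu
      obtain ⟨h1, ⟨r', h2, h3, h4, h5⟩, h6⟩ := hS.valid v w hv hu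
      refine ⟨h1, ?_, hrest h6⟩
      by_cases hwp : w.proc = p
      · rw [hwp, hp] at h2
        cases h2
        refine ⟨{ r with pc := pc }, by simp [hwp], h3, ?_, h5⟩
        rcases hend with h | h
        · exact h
        -- The proposer could leave `propose` only in a decided round, whereas `v` is the view of
        -- the undecided one.
        · have := hcur.1
          rw [h3] at this h
          have h7 : v.t = D.length := by
            have := (hcur.unique (current_last hv) (by rw [h3])).1
            rwa [h3] at this
          omega
      · exact ⟨r', by rwa [Function.update_of_ne hwp], h3, h4, h5⟩
    by_cases hl : v.l = r.view.l
    · obtain ⟨hN, rfl⟩ := (current_last hv).unique hcur hl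
      rw [hat, hself, hN] at hw
      rcases Snap.Uses.of_step hs hw with hw | ⟨hn, hpcw⟩
      · exact hold (hN ▸ hw)
      · have hrn : r.pc.est = none := by
          by_contra hne
          rw [pcAt_eq hp hne] at hn
          exact hne hn
        have hpcw : pc = .test w 0 := by
          split at hpcw
          · exact hpcw
          · cases hpcw
        obtain ⟨h1, h2, h3, h4⟩ := hstart w hrn hpcw
        refine ⟨by omega, ⟨{ r with pc := pc }, by simp [h2], rfl, by simp [hpcw, PC.est], h3⟩,
          hrest (h4 hN.symm)⟩
    · rw [hat' _ hl, hne _ hl] at hw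
      exact hold hw

open Classical in
/-- A process writes the decision of the last round. -/
theorem Safe.append (hS : Safe T D m proc) {p : P} {r : Run P S O R} {u : Decision P S}
    (hp : proc p = .inr r) (hr : r.pc = .decide u) (ht : r.view.t = D.length) :
    Valid T D.length r.view proc u ∧
    Safe T (D ++ [u])
      (m.setCons r.view.l { m.cons r.view.l with d := ⟨r.view.t, some u⟩ }) proc := by
  have hest : r.pc.est = some u := by rw [hr]; rfl
  have hact : r.pc.Active := .inr (by simp [hest])
  have hcur := hS.current p r hp hact
  have hat := pcAt_eq hp (by simp [hest])
  have hlast : viewOf T D D.length = some r.view := ht ▸ hcur.1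
  have hval := hS.valid r.view u hlast (.inl ⟨p, by rw [hat, hest]⟩)
  refine ⟨hval, ?_⟩
  have hself : (m.setCons r.view.l { m.cons r.view.l with d := ⟨r.view.t, some u⟩ }).cons
      r.view.l = { m.cons r.view.l with d := ⟨r.view.t, some u⟩ } := by simp [Mem.setCons]
  have hne : ∀ k, k ≠ r.view.l → (m.setCons r.view.l
      { m.cons r.view.l with d := ⟨r.view.t, some u⟩ }).cons k = m.cons k := by
    intro k hk
    simp [Mem.setCons, hk]
  have hsnap : ∀ k i, ((m.setCons r.view.l
      { m.cons r.view.l with d := ⟨r.view.t, some u⟩ }).cons k).snap i = (m.cons k).snap i := by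
    intro k i
    by_cases hk : k = r.view.l
    · subst hk; rw [hself]; rfl
    · rw [hne k hk]
  have hDi : ∀ (i : ℕ) w, D[i]? = some w → (D ++ [u])[i]? = some w := by
    intro i w h
    rw [List.getElem?_append_left (List.getElem?_eq_some_iff.1 h).1, h]
  have hDN : (D ++ [u])[D.length]? = some u := by simp
  have hDi' : ∀ (i : ℕ) w, (D ++ [u])[i]? = some w → D[i]? = some w ∨ i = D.length ∧ w = u := by
    intro i w h
    grind
  have hvi : ∀ i v, viewOf T D i = some v → viewOf T (D ++ [u]) i = some v := by
    intro i v h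
    rw [viewOf_append u (viewOf_le h), h]
  have hvi' : ∀ i v, viewOf T (D ++ [u]) i = some v → viewOf T D i = some v ∨
      i = D.length + 1 ∧ v = ⟨u.state, u.idx, u.ts⟩ := by
    intro i v h
    have hi := viewOf_le h
    simp only [List.length_append, List.length_singleton] at hi
    rcases hi.lt_or_eq with hi | hi
    · rw [viewOf_append u (by omega)] at h
      exact .inl h
    · subst hi
      rw [viewOf_append_last] at h
      exact .inr ⟨rfl, (Option.some.inj h).symm⟩
  have hcur' : ∀ i v, Current T (D ++ [u]) i v → Current T D i v ∨
      i = D.length + 1 ∧ v = ⟨u.state, u.idx, u.ts⟩ := by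
    intro i v h
    refine (hvi' i v h.1).imp_left fun h' => ⟨h', fun j v' hj hij => h.2 j v' (hvi j v' hj) hij⟩
  -- By validity, the index of the next round is not in use by any active process.
  have hnone : ∀ q, (pcAt proc u.idx q).est = none := by
    intro q
    simp only [pcAt]
    split
    · rfl
    · rename_i r' hq
      split
      · rename_i h
        exact (hval.idx q r' hq (.inr h.2) h.1).elim
      · rfl
  -- All stamps are at most `D.length`, so the next round sees initial values only.
  have hfresh : (m.cons u.idx).snap (D.length + 1) = Snap.fresh P (Decision P S) := by
    have h1 := (hS.wf u.idx).graf_ts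
    have h2 := (hS.wf u.idx).laps_ts
    simp only [Consensus.snap, Snap.fresh, Stamped.read, h1, h2, if_true]
  refine ⟨fun i w hw => ?_, fun q => hvi _ _ (hS.view q), ?_, fun i v hi hv => ?_,
    fun k w hw => ?_, hS.L, fun q r' hq hr' => ?_, fun i v h => ?_, fun i v w h hw => ?_,
    fun v w hv hw => ?_⟩
  · rcases hDi' i w hw with h | ⟨rfl, rfl⟩
    · exact hS.ts i w h
    · exact hval.ts
  · have h : m.WF ((D ++ [u]).length + 1) := fun k => (hS.wf k).mono (by simp)
    exact h.setCons ((h _).decide (by simp; omega) (by have := hval.ts; omega))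
  · by_cases hl : v.l = r.view.l
    -- Older rounds on the same object are from now on answered with the new decision.
    · refine ⟨D.length, u, ?_, hDN, by rw [hl, hself, ht]⟩
      simpa [Nat.lt_succ_iff] using hi
    · rw [hne _ hl]
      simp only [List.length_append, List.length_singleton] at hi
      rw [viewOf_append u (by omega)] at hv
      obtain ⟨j, w, h1, h2, h3⟩ := hS.decided i v (by
        rcases (Nat.lt_succ_iff.1 hi).lt_or_eq with h | h
        · exact h
        · subst h
          rw [hlast] at hv
          cases hv
          exact (hl rfl).elim) hv
      exact ⟨j, w, h1, hDi _ _ h2, h3⟩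
  · by_cases hk : k = r.view.l
    · subst hk
      rw [hself] at hw ⊢
      cases hw
      exact ⟨by rw [ht]; exact hDN, r.view, hvi _ _ hcur.1, rfl⟩
    · rw [hne _ hk] at hw ⊢
      obtain ⟨h1, v, h2, h3⟩ := hS.written k w hw
      exact ⟨hDi _ _ h1, v, hvi _ _ h2, h3⟩
  · obtain ⟨h1, h2⟩ := hS.current q r' hq hr'
    refine ⟨hvi _ _ h1, fun j v' hj hij => ?_⟩
    rcases hvi' j v' hj with h | ⟨rfl, rfl⟩
    · exact h2 j v' h hij
    · exact (hval.idx q r' hq hr').symm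
  · rw [hsnap]
    rcases hcur' i v h with h | ⟨rfl, rfl⟩
    · exact hS.inv i v h
    · dsimp only
      rw [hfresh]
      exact Snap.inv_fresh hnone
  · rw [hsnap]
    rcases hcur' i v h with hc | ⟨rfl, rfl⟩
    · rcases hDi' i w hw with h' | ⟨rfl, rfl⟩
      · exact hS.committed i v w hc h'
      · obtain rfl := Option.some.inj (hc.1.symm.trans hlast)
        exact (hS.inv _ _ hc).decide p w (by rw [hat, hr])
    · simp at hw
  · simp only [List.length_append, List.length_singleton] at hv hw
    rw [viewOf_append_last] at hv
    cases hv
    rw [hsnap, hfresh] at hw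
    rcases hw with ⟨q, hq⟩ | ⟨n, hn⟩
    · rw [hnone] at hq; cases hq
    · cases hn

end Safety

/-! ### Histories and their linearizations -/

/-- The state that is reached from `s` by the operations of a sequence. -/
def _root_.SeqType.run (T : SeqType S O R) (s : S) (l : List (O × R)) : S :=
  l.foldl (fun s x => (T.τ s x.1).1) s

theorem _root_.SeqType.legal_append (T : SeqType S O R) (s : S) (l : List (O × R)) (x : O × R) :
    T.Legal s (l ++ [x]) ↔ T.Legal s l ∧ (T.τ (T.run s l) x.1).2 = x.2 := by
  induction l generalizing s with
  | nil => simp [SeqType.Legal, SeqType.run]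
  | cons y l ih => simp [SeqType.Legal, ih, SeqType.run, and_assoc]

/-- The operations and the responses of a linearization. -/
def ops (l : List (LinOp O R)) : List (O × R) := l.map fun x => (x.op, x.resp)

/-- Process `q` invoked at position `i` an operation that did not return. -/
def Pending (h : List (Event P O R)) (q : P) (i : ℕ) : Prop :=
  (∃ o, h[i]? = some (.inv q o)) ∧ ∀ j v, i < j → h[j]? ≠ some (.res q v)

theorem getElem?_append_singleton {α : Type*} {l : List α} {a b : α} {i : ℕ} :
    (l ++ [a])[i]? = some b ↔ l[i]? = some b ∨ i = l.length ∧ a = b := by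
  grind

theorem pending_inv {h : List (Event P O R)} {p q : P} {o : O} {i : ℕ} :
    Pending (h ++ [.inv p o]) q i ↔ Pending h q i ∨ q = p ∧ i = h.length := by
  simp only [Pending, ne_eq, getElem?_append_singleton, reduceCtorEq, and_false, or_false]
  constructor
  · rintro ⟨⟨o', ho | ⟨rfl, ho⟩⟩, h2⟩
    · exact .inl ⟨⟨o', ho⟩, h2⟩
    · cases ho; exact .inr ⟨rfl, rfl⟩
  · rintro (⟨⟨o', ho⟩, h2⟩ | ⟨rfl, rfl⟩)
    · exact ⟨⟨o', .inl ho⟩, h2⟩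
    · refine ⟨⟨o, .inr ⟨rfl, rfl⟩⟩, fun j v hj => ?_⟩
      rw [List.getElem?_eq_none hj.le]
      simp

theorem pending_res {h : List (Event P O R)} {p q : P} {v : R} {i : ℕ} :
    Pending (h ++ [.res p v]) q i ↔ Pending h q i ∧ q ≠ p := by
  simp only [Pending, ne_eq, getElem?_append_singleton, reduceCtorEq, and_false, or_false]
  constructor
  · rintro ⟨⟨o', ho⟩, h2⟩
    refine ⟨⟨⟨o', ho⟩, fun j w hj hw => h2 j w hj (.inl hw)⟩, ?_⟩
    rintro rfl
    exact h2 h.length v (List.getElem?_eq_some_iff.1 ho).1 (.inr ⟨rfl, rfl⟩)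
  · rintro ⟨⟨⟨o', ho⟩, h2⟩, hq⟩
    refine ⟨⟨o', ho⟩, fun j w hj hw => ?_⟩
    rcases hw with hw | ⟨-, hw⟩
    · exact h2 j w hj hw
    · cases hw; exact hq rfl

theorem returns_inv {h : List (Event P O R)} {p : P} {o : O} {i j : ℕ} {v : R} :
    Returns (h ++ [.inv p o]) i j v ↔ Returns h i j v := by
  simp only [Returns, ne_eq, getElem?_append_singleton, reduceCtorEq, and_false, or_false]
  constructor
  · rintro ⟨q, o', ho | ⟨rfl, ho⟩, hij, hj, h2⟩
    · exact ⟨q, o', ho, hij, hj, h2⟩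
    · rw [List.getElem?_eq_none hij.le] at hj
      cases hj
  · rintro ⟨q, o', ho, hij, hj, h2⟩
    exact ⟨q, o', .inl ho, hij, hj, h2⟩

theorem returns_of_res {h : List (Event P O R)} {p : P} {v w : R} {i j : ℕ}
    (hr : Returns (h ++ [.res p v]) i j w) :
    Returns h i j w ∨ Pending h p i ∧ j = h.length ∧ w = v := by
  simp only [Returns, ne_eq, getElem?_append_singleton, reduceCtorEq, and_false, or_false] at hr
  obtain ⟨q, o', ho, hij, hj | ⟨rfl, hj⟩, h2⟩ := hr
  · exact .inl ⟨q, o', ho, hij, hj, fun k w hk hk' hw => h2 k w hk hk' (.inl hw)⟩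
  · cases hj
    refine .inr ⟨⟨⟨o', ho⟩, fun k w hk hw => ?_⟩, rfl, rfl⟩
    exact h2 k w hk (List.getElem?_eq_some_iff.1 hw).1 (.inl hw)

section Linearization

variable {T : SeqType S O R} {h : List (Event P O R)} {l : List (LinOp O R)}

theorem linearization_nil : IsLinearization T ([] : List (Event P O R)) [] := by
  constructor <;> simp [SeqType.Legal, Returns]

/-- A pending operation has not returned, so it precedes nothing in real time and may be placed
last. -/
theorem _root_.IsLinearization.append (hl : IsLinearization T h l) {q : P} {i : ℕ} {o : O} {v : R}
    (hi : Pending h q i) (ho : h[i]? = some (.inv q o)) (hn : ∀ x ∈ l, x.pos ≠ i)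
    (hv : (T.τ (T.run T.init (ops l)) o).2 = v) : IsLinearization T h (l ++ [⟨i, o, v⟩]) := by
  refine ⟨?_, ?_, fun j k w hr => ?_, ?_, ?_⟩
  · rw [List.map_append, List.nodup_append]
    refine ⟨hl.nodup, by simp, ?_⟩
    simpa using hn
  · intro x hx
    rcases List.mem_append.1 hx with hx | hx
    · exact hl.invoked x hx
    · rw [List.mem_singleton.1 hx]; exact ⟨q, ho⟩
  · obtain ⟨x, hx, h2⟩ := hl.complete j k w hr
    exact ⟨x, List.mem_append_left _ hx, h2⟩
  · rw [List.pairwise_append]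
    refine ⟨hl.realTime, by simp, fun x hx y hy => ?_⟩
    rw [List.mem_singleton.1 hy]
    rintro ⟨j, w, ⟨q', o', ho', hij, hj, -⟩, -⟩
    rw [ho] at ho'
    cases ho'
    exact hi.2 j w hij hj
  · rw [List.map_append]
    exact (T.legal_append _ _ _).2 ⟨hl.legal, hv⟩

theorem _root_.IsLinearization.inv (hl : IsLinearization T h l) (p : P) (o : O) :
    IsLinearization T (h ++ [.inv p o]) l := by
  refine ⟨hl.nodup, fun x hx => ?_, fun i j v hr => hl.complete i j v (returns_inv.1 hr), ?_,
    hl.legal⟩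
  · obtain ⟨q, hq⟩ := hl.invoked x hx
    exact ⟨q, getElem?_append_singleton.2 (.inl hq)⟩
  · simpa only [returns_inv] using hl.realTime

/-- The new response comes after every invocation of `h`, so it adds no precedence between
operations of `l`. -/
theorem _root_.IsLinearization.res (hl : IsLinearization T h l) {p : P} {v : R}
    (hp : ∀ i, Pending h p i → ∃ x ∈ l, x.pos = i ∧ x.resp = v) :
    IsLinearization T (h ++ [.res p v]) l := by
  refine ⟨hl.nodup, fun x hx => ?_, fun i j w hr => ?_, ?_, hl.legal⟩
  · obtain ⟨q, hq⟩ := hl.invoked x hx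
    exact ⟨q, getElem?_append_singleton.2 (.inl hq)⟩
  · rcases returns_of_res hr with hr | ⟨hi, -, rfl⟩
    · exact hl.complete i j w hr
    · exact hp i hi
  · refine hl.realTime.imp_of_mem ?_
    rintro x y hx - hn ⟨j, w, hr, hj⟩
    rcases returns_of_res hr with hr | ⟨-, rfl, -⟩
    · exact hn ⟨j, w, hr, hj⟩
    · obtain ⟨q, hq⟩ := hl.invoked x hx
      have := (List.getElem?_eq_some_iff.1 hq).1
      omega

end Linearization

/-! ### Linearization points -/

open Classical in
/-- The response of the pending operation of `q`, if this operation is linearized. -/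
noncomputable def response (T : SeqType S O R) (D : List (Decision P S)) (q : P)
    (r : Run P S O R) : Option R :=
  match r.pc with
  | .ret v => some v
  | _ => if r.pc.est ≠ none ∧ ∃ w, D[r.view.t]? = some w ∧ w.proc = q then
      some (T.τ r.view.s r.op).2 else none

/-- `l` linearizes the history `h`, when `D` are the decisions of the rounds. -/
structure Linearizes (T : SeqType S O R) (h : List (Event P O R)) (D : List (Decision P S))
    (l : List (LinOp O R)) (proc : P → View S ⊕ Run P S O R) : Prop where
  lin : IsLinearization T h l
  run : ∀ v, viewOf T D D.length = some v → T.run T.init (ops l) = v.s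
  idle : ∀ q v i, proc q = .inl v → ¬ Pending h q i
  running : ∀ q r, proc q = .inr r → ∃ i, h[i]? = some (.inv q r.op) ∧
    (∀ j, Pending h q j ↔ j = i) ∧ (∀ v, response T D q r = some v → ⟨i, r.op, v⟩ ∈ l) ∧
    (response T D q r = none → ∀ x ∈ l, x.pos ≠ i)
  free : ∀ q r w, proc q = .inr r → r.pc = .free → D[r.view.t]? = some w → w.proc ≠ q

theorem response_of_est {T : SeqType S O R} {D : List (Decision P S)} {q : P} {r : Run P S O R}
    (hr : r.pc.est = none) (hr' : ∀ v, r.pc ≠ .ret v) : response T D q r = none := by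
  unfold response
  split
  · exact (hr' _ ‹_›).elim
  · simp [hr]

open Classical in
theorem response_est {T : SeqType S O R} {D : List (Decision P S)} {q : P} {r : Run P S O R}
    (hr : r.pc.est ≠ none) : response T D q r =
      if ∃ w, D[r.view.t]? = some w ∧ w.proc = q then some (T.τ r.view.s r.op).2 else none := by
  unfold response
  split
  · simp_all [PC.est]
  · simp [hr]

/-- The round being decided, the operation is already linearized exactly when the decision bears the
name of `p`, which is the test that `proposed` makes. -/
theorem response_proposed {T : SeqType S O R} {D : List (Decision P S)} {p : P}
    {r : Run P S O R} {w : Decision P S} (hr : r.pc.est ≠ none) (hw : D[r.view.t]? = some w) :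
    response T D p { r with pc := proposed T p r w } = response T D p r := by
  rw [response_est hr]
  unfold proposed
  by_cases hp : w.proc = p
  · simp [response, hp, hw]
  · simp [response, hp, hw, PC.est]

section Steps

variable {T : SeqType S O R} {h : List (Event P O R)} {D : List (Decision P S)}
  {l : List (LinOp O R)} {proc : P → View S ⊕ Run P S O R}

open Classical in
theorem Linearizes.step (hL : Linearizes T h D l proc) {p : P} {r r' : Run P S O R}
    (hp : proc p = .inr r) (ho : r'.op = r.op) (hr : response T D p r' = response T D p r)
    (hf : ∀ w, r'.pc = .free → D[r'.view.t]? = some w → w.proc ≠ p) :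
    Linearizes T h D l (Function.update proc p (.inr r')) := by
  refine ⟨hL.lin, hL.run, fun q v i hq => ?_, fun q r'' hq => ?_, fun q r'' w hq => ?_⟩
  all_goals by_cases hqp : q = p
  · subst hqp; simp at hq
  · rw [Function.update_of_ne hqp] at hq; exact hL.idle q v i hq
  · subst hqp
    simp only [Function.update_self, Sum.inr.injEq] at hq
    subst hq
    have := hL.running q r hp
    rwa [← ho, ← hr] at this
  · rw [Function.update_of_ne hqp] at hq; exact hL.running q r'' hq
  · subst hqp
    simp only [Function.update_self, Sum.inr.injEq] at hq
    subst hq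
    exact hf w
  · rw [Function.update_of_ne hqp] at hq; exact hL.free q r'' w hq

/-- The pending operation of `q` is linearized, while the decisions become `D'`. -/
theorem Linearizes.linearize (hL : Linearizes T h D l proc) {q : P} {r r' : Run P S O R}
    {D' : List (Decision P S)} {proc' : P → View S ⊕ Run P S O R} {v v' : View S}
    (hq : proc q = .inr r) (hr : response T D q r = none) (hv : viewOf T D D.length = some v)
    (hv' : viewOf T D' D'.length = some v') (hs : (T.τ v.s r.op).1 = v'.s)
    (hne : ∀ q', q' ≠ q → proc' q' = proc q')
    (hres : ∀ q' r', q' ≠ q → proc q' = .inr r' → response T D' q' r' = response T D q' r')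
    (hq' : proc' q = .inr r') (ho : r'.op = r.op)
    (hr' : response T D' q r' = some (T.τ v.s r.op).2)
    (hf : ∀ q r w, proc' q = .inr r → r.pc = .free → D'[r.view.t]? = some w → w.proc ≠ q) :
    ∃ l', Linearizes T h D' l' proc' := by
  obtain ⟨i, hi, hpend, -, hnone⟩ := hL.running q r hq
  have hrun := hL.run v hv
  refine ⟨l ++ [⟨i, r.op, (T.τ v.s r.op).2⟩],
    hL.lin.append ((hpend i).2 rfl) hi (hnone hr) (by rw [hrun]), fun v₁ hv₁ => ?_,
    fun q₁ v₁ j hq₁ => ?_, fun q₁ r₁ hq₁ => ?_, hf⟩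
  · rw [hv'] at hv₁
    cases hv₁
    rw [← hs, ← hrun]
    simp [SeqType.run, ops]
  · by_cases hqq : q₁ = q
    · subst hqq; rw [hq'] at hq₁; cases hq₁
    · exact hL.idle q₁ v₁ j (hne q₁ hqq ▸ hq₁)
  · by_cases hqq : q₁ = q
    · subst hqq
      obtain rfl := Sum.inr.inj (hq'.symm.trans hq₁)
      refine ⟨i, ho ▸ hi, hpend, fun w hw => ?_, fun hn => ?_⟩
      · rw [hr'] at hw
        cases hw
        simp [ho]
      · rw [hr'] at hn; cases hn
    · rw [hne q₁ hqq] at hq₁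
      obtain ⟨j, hj, hpj, h1, h2⟩ := hL.running q₁ r₁ hq₁
      rw [hres q₁ r₁ hqq hq₁]
      refine ⟨j, hj, hpj, fun w hw => List.mem_append_left _ (h1 w hw), fun hn x hx => ?_⟩
      rcases List.mem_append.1 hx with hx | hx
      · exact h2 hn x hx
      · rw [List.mem_singleton.1 hx]
        rintro rfl
        have := hi.symm.trans hj
        simp only [Option.some.injEq, Event.inv.injEq] at this
        exact hqq this.1.symm

open Classical in
theorem Linearizes.invoke (hL : Linearizes T h D l proc) {p : P} {v : View S} (o : O)
    (hp : proc p = .inl v) : Linearizes T (h ++ [.inv p o]) D l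
      (Function.update proc p (.inr ⟨v, o, .enter⟩)) := by
  refine ⟨hL.lin.inv p o, hL.run, fun q v' i hq => ?_, fun q r hq => ?_, fun q r w hq => ?_⟩
  all_goals by_cases hqp : q = p
  · subst hqp; simp at hq
  · rw [Function.update_of_ne hqp] at hq
    simp [pending_inv, hqp, hL.idle q v' i hq]
  · subst hqp
    simp only [Function.update_self, Sum.inr.injEq] at hq
    subst hq
    refine ⟨h.length, by simp, fun j => ?_, fun w hw => ?_, fun _ x hx => ?_⟩
    · simp [pending_inv, hL.idle q v j hp]
    · simp [response, PC.est] at hw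
    · obtain ⟨q', hq'⟩ := hL.lin.invoked x hx
      have := (List.getElem?_eq_some_iff.1 hq').1
      omega
  · rw [Function.update_of_ne hqp] at hq
    obtain ⟨i, hi, hpi, h1, h2⟩ := hL.running q r hq
    exact ⟨i, getElem?_append_singleton.2 (.inl hi), fun j => by simp [pending_inv, hqp, hpi],
      h1, h2⟩
  · subst hqp
    simp only [Function.update_self, Sum.inr.injEq] at hq
    subst hq
    simp
  · rw [Function.update_of_ne hqp] at hq
    exact hL.free q r w hq

open Classical in
theorem Linearizes.respond (hL : Linearizes T h D l proc) {p : P} {r : Run P S O R} {v : R}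
    (hp : proc p = .inr r) (hr : r.pc = .ret v) : Linearizes T (h ++ [.res p v]) D l
      (Function.update proc p (.inl r.view)) := by
  obtain ⟨i, hi, hpi, h1, -⟩ := hL.running p r hp
  have hmem := h1 v (by simp [response, hr])
  refine ⟨hL.lin.res fun j hj => ⟨_, hmem, ((hpi j).1 hj).symm, rfl⟩, hL.run,
    fun q v' j hq => ?_, fun q r' hq => ?_, fun q r' w hq => ?_⟩
  all_goals by_cases hqp : q = p
  · simp [pending_res, hqp]
  · rw [Function.update_of_ne hqp] at hq
    simp [pending_res, hL.idle q v' j hq]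
  · subst hqp; simp at hq
  · rw [Function.update_of_ne hqp] at hq
    obtain ⟨j, hj, hpj, h1, h2⟩ := hL.running q r' hq
    exact ⟨j, getElem?_append_singleton.2 (.inl hj), fun k => by simp [pending_res, hqp, hpj],
      h1, h2⟩
  · subst hqp; simp at hq
  · rw [Function.update_of_ne hqp] at hq
    exact hL.free q r' w hq

variable {m m' : Mem P S} {p : P} {r r' : Run P S O R}

open Classical in
/-- The call to `propose` returns the decision `w` of its round. -/
theorem Safe.finish (hS : Safe T D m proc) (hL : Linearizes T h D l proc) (hp : proc p = .inr r)
    {w : Decision P S} (hr : r.pc.est ≠ none) (hw : D[r.view.t]? = some w) :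
    Safe T D m (Function.update proc p (.inr { r with pc := proposed T p r w })) ∧
    Linearizes T h D l (Function.update proc p (.inr { r with pc := proposed T p r w })) := by
  constructor
  · have := hS.propose_step (o := m.cons r.view.l) (pc := proposed T p r w) hp (.inr hr) rfl
      (hS.wf _) (.exit (by rw [if_neg (by simp [proposed_est])]; rfl))
      (.inr (List.getElem?_eq_some_iff.1 hw).1) fun _ h => (hr h).elim
    rwa [Mem.setCons_self] at this
  · refine hL.step hp rfl (response_proposed hr hw) fun _ h => ?_
    simp only [proposed] at h
    split at h <;> cases h

open Classical in
/-- The decision `u` is written in the last round: this linearizes the operation of the process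
that proposed `u`. -/
theorem Linearizes.append (hL : Linearizes T h D l proc) {v : View S} {u : Decision P S}
    (hts : ∀ (i : ℕ) w, D[i]? = some w → w.ts = i + 1)
    (hv : viewOf T D D.length = some v) (hval : Valid T D.length v proc u) :
    ∃ l', Linearizes T h (D ++ [u]) l' proc := by
  obtain ⟨h1, ⟨r, hq, rfl, hest, hs⟩, -⟩ := hval
  have ht : r.view.t = D.length := by
    cases hD : D.length with
    | zero => rw [hD] at hv; rw [← Option.some.inj hv]
    | succ n =>
      rw [hD] at hv
      simp only [viewOf, Option.map_eq_some_iff] at hv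
      obtain ⟨w, hw, hv⟩ := hv
      rw [← hv]
      exact hts n w hw
  have hget : ∀ (i : ℕ) w, (D ++ [u])[i]? = some w ↔ D[i]? = some w ∨ i = D.length ∧ u = w :=
    fun i w => getElem?_append_singleton
  refine hL.linearize (v' := ⟨u.state, u.idx, u.ts⟩) hq ?_ hv ?_ hs.symm (fun _ _ => rfl)
    (fun q' r' hne hq' => ?_) hq rfl ?_ fun q r' w hq' hr' hw => ?_
  · rw [response_est hest, ht]
    simp
  · simp [viewOf]
  · have : (∃ w, (D ++ [u])[r'.view.t]? = some w ∧ w.proc = q') ↔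
        ∃ w, D[r'.view.t]? = some w ∧ w.proc = q' := by
      simp only [hget]
      constructor
      · rintro ⟨w, hw | ⟨-, rfl⟩, h⟩
        · exact ⟨w, hw, h⟩
        · exact (hne h.symm).elim
      · rintro ⟨w, hw, h⟩
        exact ⟨w, .inl hw, h⟩
    simp only [response, this]
  · rw [response_est hest, ht]
    simp
  · rcases (hget _ _).1 hw with hw | ⟨-, rfl⟩
    · exact hL.free q r' w hq' hr' hw
    · rintro rfl
      rw [hq] at hq'
      cases hq'
      exact hest (by rw [hr']; rfl)

open Classical in
-- `D` grows when the last round gets its first decision, and `l` grows then and when an operation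
-- that keeps the state finds its round undecided. No other step changes a `response`.
theorem Safe.step {A : Set P} (hA : A.Finite) (hB : Basic A m proc) (hS : Safe T D m proc)
    (hL : Linearizes T h D l proc) (hp : proc p = .inr r) (hm : Move T p m r m' (.inl r')) :
    ∃ D' l', Safe T D' m' (Function.update proc p (.inr r')) ∧
      Linearizes T h D' l' (Function.update proc p (.inr r')) := by
  have hview : viewOf T D r.view.t = some r.view := by
    have := hS.view p
    rwa [hp] at this
  cases hm with
  | enter hpc =>
    refine ⟨D, l, hS.local_step (fun r' h => ?_) (fun r' h => ?_) (fun q hq => ?_) hview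
      (fun r' h _ => ?_) (fun r' h h' => ?_), hL.step hp rfl ?_ (by simp)⟩
    · rw [hp] at h; cases h; simp [hpc, PC.est]
    · cases h; rfl
    · simp [hq]
    · cases h; simp
    · cases h; cases h'
    · rw [response_of_est rfl (by simp), response_of_est (by simp [hpc, PC.est]) (by simp [hpc])]
  | jump w hpc hw =>
    refine ⟨D, l, hS.local_step (L := m.L) (fun r' h => ?_) (fun r' h => ?_) (fun q hq => rfl)
      (hS.jump hw) (fun r' h h' => ?_) (fun r' h h' => ?_), hL.step hp rfl ?_ (by simp)⟩
    · rw [hp] at h; cases h; simp [hpc, PC.est]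
    · cases h; rfl
    · cases h; simp at h'
    · cases h; cases h'
    · rw [response_of_est rfl (by simp), response_of_est (by simp [hpc, PC.est]) (by simp [hpc])]
  | read hpc hd hs =>
    have ht := hS.last_of_read hview hd
    -- The round is the last one, so the local state is the state reached by `l`, and the operation
    -- can be appended.
    obtain ⟨l', hl'⟩ := hL.linearize (D' := D) (r' := { r with pc := .ret (T.τ r.view.s r.op).2 })
      (proc' := Function.update proc p (.inr { r with pc := .ret (T.τ r.view.s r.op).2 })) hp
      (response_of_est (by simp [hpc, PC.est]) (by simp [hpc])) (ht ▸ hview) (ht ▸ hview) hs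
      (fun q hq => by simp [hq]) (fun _ _ _ _ => rfl) (by simp) rfl rfl fun q r' w hq hr' => by
        by_cases hqp : q = p
        · subst hqp
          simp only [Function.update_self, Sum.inr.injEq] at hq
          subst hq
          cases hr'
        · rw [Function.update_of_ne hqp] at hq
          exact hL.free q r' w hq hr'
    refine ⟨D, l', hS.local_step (L := m.L) (fun r' h => ?_) (fun r' h => ?_) (fun q hq => rfl)
      hview (fun r' h h' => ?_) (fun r' h h' => ?_), hl'⟩
    · rw [hp] at h; cases h; simp [hpc, PC.est]
    · cases h; rfl
    · cases h; simp at h'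
    · cases h; cases h'
  | free hpc hd =>
    have ht := hS.last_of_read hview hd
    refine ⟨D, l, hS.local_step (L := m.L) (fun r' h => ?_) (fun r' h => ?_) (fun q hq => rfl)
      hview (fun r' h h' => ?_) (fun r' h h' => ?_), hL.step hp rfl ?_ ?_⟩
    · rw [hp] at h; cases h; simp [hpc, PC.est]
    · cases h; rfl
    · cases h; exact hS.L p r hp (.inl hpc)
    · cases h; exact ht
    · rw [response_of_est rfl (by simp), response_of_est (by simp [hpc, PC.est]) (by simp [hpc])]
    · simp [ht]
  | start hpc =>
    have hnone : r.pc.est = none := by rw [hpc]; rfl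
    refine ⟨D, l, ?_, hL.step hp rfl ?_ (by simp)⟩
    · have := hS.propose_step (o := m.cons r.view.l)
        (pc := .test ⟨(T.τ r.view.s r.op).1, p, freeIndex m.L, r.view.t + 1⟩ 0) hp (.inl hpc) rfl
        (hS.wf _) ?_ (.inl (by simp [PC.est])) ?_
      · rwa [Mem.setCons_self] at this
      · exact .start (by simp only [pcAt, hp, hnone]; simp [PC.est])
      · rintro w - ⟨⟩
        refine ⟨rfl, rfl, rfl, fun _ q r' hq hr' heq => ?_⟩
        -- Every active process still announces its index in `L`, which the free index avoids.
        exact (freeIndex_spec hA hB.L).2 q ((hS.L q r' hq (.inr hr')).trans (by rw [heq]))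
    · rw [response_of_est hnone (by simp [hpc]), response_est (by simp [PC.est])]
      -- The round may have been decided while `p` was at `free`, but not with a proposal of `p`,
      -- which had made none in it.
      have := hL.free p r
      simp only [ite_eq_right_iff, reduceCtorEq, imp_false]
      rintro ⟨w, hw, hwp⟩
      exact this w hp hpc hw hwp
  | decided u n w hpc hw =>
    have hest : r.pc.est ≠ none := by rw [hpc]; simp [PC.est]
    have hD := (hS.read_iff (hS.current p r hp (.inr hest))).1 hw
    exact ⟨D, l, hS.finish hL hp hest hD⟩
  | propose u u' o pc hpc hpc' hw hs =>
    have hest : r.pc.est ≠ none := by simp [hpc]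
    have hest' : pc.est ≠ none := by simp [hpc']
    have ht := viewOf_le hview
    refine ⟨D, l, hS.propose_step hp (.inr hest) (by cases hw <;> rfl)
      ((hS.wf _).writes hw (by omega) (hB.est p r u hp hpc).2) ?_ (.inl hest')
      (fun _ h => (hest h).elim), hL.step hp rfl ?_ ?_⟩
    · rw [pcAt_eq hp hest, if_pos hest']
      exact hs
    · rw [response_est hest, response_est hest']
    · rintro w rfl
      simp [PC.est] at hpc'
  | decide u hpc =>
    have hest : r.pc.est ≠ none := by rw [hpc]; simp [PC.est]
    have hcur := hS.current p r hp (.inr hest)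
    by_cases ht : r.view.t = D.length
    · obtain ⟨hval, hS'⟩ := hS.append hp hpc ht
      obtain ⟨l', hL'⟩ := hL.append hS.ts (ht ▸ hview) hval
      exact ⟨_, l', hS'.finish hL' hp hest (by simp [ht])⟩
    -- A late writer: by agreement its value is the decision of its round, and as the object has not
    -- been reused, the write changes nothing.
    · have hlt : r.view.t < D.length := (viewOf_le hview).lt_of_ne ht
      have hw : D[r.view.t]? = some D[r.view.t] := List.getElem?_eq_getElem hlt
      obtain ⟨n, hn⟩ := hS.committed _ _ _ hcur hw
      obtain ⟨n', hn'⟩ := (hS.inv _ _ hcur).decide p u (by rw [pcAt_eq hp hest, hpc])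
      obtain rfl := hn'.unique hn
      obtain ⟨h1, h2⟩ := Stamped.read_eq_some.1 ((hS.read_iff hcur).2 hw)
      have hd : (m.cons r.view.l).d = ⟨r.view.t, some D[r.view.t]⟩ := by
        obtain ⟨h3, v, h4, h5⟩ := hS.written _ _ h2
        have : (m.cons r.view.l).d.ts = r.view.t := by
          by_contra hne
          exact hcur.2 _ v h4 (by omega) h5
        cases hd : (m.cons r.view.l).d
        simp_all
      rw [← hd, Mem.setCons_self]
      exact ⟨D, l, hS.finish hL hp hest hw⟩

end Steps

open Classical in
theorem exists_linearizes {T : SeqType S O R} {h : List (Event P O R)}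
    {c : (algorithm P T).Config} (hr : (algorithm P T).Reach h c) :
    ∃ D l, Safe T D c.mem c.proc ∧ Linearizes T h D l c.proc := by
  induction hr with
  | init =>
    refine ⟨[], [], ?_, linearization_nil, ?_, ?_, ?_, ?_⟩
    · have hcur : ∀ i v, Current T ([] : List (Decision P S)) i v → i = 0 := by
        intro i v h
        have := viewOf_le h.1
        simpa using this
      have hsnap : (Consensus.init P (Decision P S)).snap 0 = Snap.fresh P (Decision P S) := by
        simp [Consensus.snap, Snap.fresh, Stamped.read, Consensus.init, Grafarius.init]
      refine ⟨by simp, fun q => rfl, fun k => Consensus.wf_init, by simp, fun k w hw => ?_,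
        fun q r hq => ?_, fun q r hq => ?_, fun i v h => ?_, by simp, fun v w hv hw => ?_⟩
      · cases hw
      · cases hq
      · cases hq
      · rw [hcur i v h]
        simp only [Implementation.initial, algorithm, hsnap]
        exact Snap.inv_fresh fun q => rfl
      · simp only [Implementation.initial, algorithm, List.length_nil, hsnap] at hw
        rcases hw with ⟨q, hq⟩ | ⟨n, hn⟩
        · cases hq
        · cases hn
    · rintro v ⟨⟩; rfl
    · simp [Pending]
    · rintro q r ⟨⟩
    · rintro q r w ⟨⟩
  | @invoke h c p o i hr hp ih =>
    obtain ⟨D, l, hS, hL⟩ := ih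
    refine ⟨D, l, hS.local_step (L := c.mem.L) (fun r hr => ?_) (fun r hr => ?_) (fun q hq => rfl)
      ?_ (fun r hr h => ?_) (fun r hr h => ?_), hL.invoke o hp⟩
    · rw [hp] at hr; cases hr
    · cases hr; rfl
    · have := hS.view p
      rwa [hp] at this
    · cases hr; simp [algorithm] at h
    · cases hr; cases h
  | @step h c p r r' m hr hp hs ih =>
    obtain ⟨D, l, hS, hL⟩ := ih
    exact hS.step (finite_participants h) (Basic.reach hr) hL hp (Move.of_step hs (hS.wf _).laps)
  | @respond h c p r m i v hr hp hs ih =>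
    obtain ⟨D, l, hS, hL⟩ := ih
    have hm := Move.of_step hs (hS.wf _).laps
    generalize hx : (Sum.inr (i, v) : Run P S O R ⊕ (View S × R)) = x at hm
    cases hm
    cases hx
    rename_i hpc
    refine ⟨D, l, hS.local_step (L := c.mem.L) (fun r' hr' => ?_) (fun r' hr' => ?_)
      (fun q hq => rfl) ?_ (fun r' hr' => ?_) (fun r' hr' => ?_), hL.respond hp hpc⟩
    · rw [hp] at hr'; cases hr'; simp [hpc, PC.est]
    · cases hr'
    · have := hS.view p
      rwa [hp] at this
    · cases hr'
    · cases hr'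

theorem linearizable (P : Type*) {S O R : Type*} (T : SeqType S O R) :
    (algorithm P T).Linearizable T := by
  intro h c hr
  obtain ⟨D, l, -, hL⟩ := exists_linearizes hr
  exact ⟨l, hL.lin⟩

end Buniv

theorem mainTheorem1 (P : Type*) {S O R : Type*} (T : SeqType S O R) :
    (Buniv.algorithm P T).ObstructionFree ∧
    (Buniv.algorithm P T).Linearizable T ∧
    Buniv.RecyclesConsensus P T :=
  ⟨Buniv.obstructionFree P T, Buniv.linearizable P T, Buniv.recyclesConsensus P T⟩
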